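/- **Ordinal terms and Hardy functions.** Ordinal terms are generated by $0$, $\omega^\alpha$ and $\alpha+\beta$, where $+$ is associative with neutral element $0$ (terms need not be in Cantor normal form); each term is thus $0$ or uniquely of the form $\gamma+\omega^\beta$. Terms are compared through the set-theoretic ordinals they denote. Write $\Omega_0=1=\omega^0$ and $\Omega_{n+1}=\omega^{\Omega_n}$. A term $\gamma+\omega^\beta$ is a successor if $\beta=0$ (also written $\gamma+1$) and a limit otherwise; for limits put $(\gamma+\omega^{\delta+1})_n=\gamma+\omega^\delta\cdot n$ and $(\gamma+\omega^{\lambda})_n=\gamma+\omega^{\lambda_n}$ for $\lambda$ a limit. The Hardy functions $H^\alpha:\mathbb N\to\mathbb N$ are given by $H^0(n)=n$, $H^{\alpha+1}(n)=H^\alpha(n+1)$ and $H^\lambda(n)=H^{\lambda_n}(n)$ for limits $\lambda$. **Priority channel systems.** Let $\Sigma_d=\{0,\dots,d\}$. A $d$-PCS consists of a finite set of channels, a finite set $Q$ of control states, and a set of rules $(q,c,!,a,q')$ (write $a$ on channel $c$) and $(q,c,?,a,q')$ (read $a$ from channel $c$) with $a\in\Sigma_d$. A configuration is a control state together with a word of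 $\Sigma_d^*$ on each channel. In the write-superseding semantics, a step $\to_w$ by a reading rule changes the state from $q$ to $q'$ and removes $a$ from the front of channel $c$; a step by a writing rule changes the state from $q$ to $q'$ and replaces the content $zz'$ of channel $c$ by $za$, for any factorization $zz'$ of the content such that $z'$ contains only messages $\le a$. The other channels are unchanged. **Codes.** Let $P_{-1}=\{\varepsilon\}$ and $P_a=(P_{a-1}a)^*$. For a term $\alpha<\Omega_{d+1}$ let $s(\alpha)=s_d(\alpha)\in P_d$, where $s_a(0)=\varepsilon$ and $s_a(\gamma+\omega^\beta)=s_a(\gamma)\,s_{a-1}(\beta)\,a$. **Weak Hardy computers.** A *weak Hardy computer* for $\Omega_{d+1}$ is a $(d+1)$-PCS with three channels (written in the order $\mathtt o,\mathtt c,\mathtt t$) and two distinguished states $p_{\mathrm{init}},p_{\mathrm{final}}$ such that, writing $\$$ for the message $d+1$: - (safety) for all $x,y,z\in\Sigma_d^*$ and all words $u,v,w\in\Sigma_{d+1}^*$, if $(p_{\mathrm{init}},x\$,y\$,z\$)\to_w^*(p_{\mathrm{final}},u,v,w)$, then $x\in P_d$, $y\in 0^+$, $z=\varepsilon$ and $u,v,w\in\Sigma_d^*\$$;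 - (robustness) for all terms $\alpha,\beta<\Omega_{d+1}$ and all $n,m\in\mathbb N$, if $(p_{\mathrm{init}},s(\alpha)\$,0^n\$,\$)\to_w^*(p_{\mathrm{final}},s(\beta)\$,0^m\$,\$)$, then $H^\alpha(n)\ge H^\beta(m)$. It is *complete* if for every term $\alpha<\Omega_{d+1}$ and every $n>0$, with $m=H^\alpha(n)$, it has a run $(p_{\mathrm{init}},s(\alpha)\$,0^n\$,\$)\to_w^*(p_{\mathrm{final}},\$,0^m\$,\$)$. It is *inv-complete* if for every such $\alpha$, $n$ and $m$ it has a run $(p_{\mathrm{init}},\$,0^m\$,\$)\to_w^*(p_{\mathrm{final}},s(\alpha)\$,0^n\$,\$)$. **Lemma (PCSs weakly compute Hardy functions).** For every $d\in\mathbb N$ there is a weak Hardy computer $S_d$ for $\Omega_{d+1}$ that is complete, and a weak Hardy computer $S'_d$ for $\Omega_{d+1}$ that is inv-complete. Moreover both can be generated uniformly from $d$: there are algorithms that, on input $d$, output a finite description of $S_d$, respectively of $S'_d$ (the number of states, the list of rules, and the states $p_{\mathrm{init}},p_{\mathrm{final}}$). -/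

import Mathlib

/-! ### Ordinal terms and the Hardy functions -/

/-- Ordinal terms, generated by `0`, `ω^α` and `α + β`, where `+` is associative with neutral
element `0`.  Every such term is either `0` or, in a unique way, of the form `γ + ω^β`; the
constructor `addExp γ β` stands for `γ + ω^β`.  Terms need not be in Cantor normal form. -/
inductive OrdTerm : Type
  | zero : OrdTerm
  | addExp (γ β : OrdTerm) : OrdTerm

namespace OrdTerm

/-- The set-theoretic ordinal `o(α)` denoted by a term. -/
noncomputable def toOrdinal : OrdTerm → Ordinal.{0}
  | zero => 0
  | addExp γ β => γ.toOrdinal + Ordinal.omega0 ^ β.toOrdinal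

/-- Terms are compared through the ordinals that they denote. -/
noncomputable instance : LT OrdTerm := ⟨fun α β => α.toOrdinal < β.toOrdinal⟩

/-- The tower `Ω_n` of `n` stacked `ω`'s: `Ω_0 = 1 = ω^0` and `Ω_{n+1} = ω^{Ω_n}`. -/
def tower : ℕ → OrdTerm
  | 0 => addExp zero zero
  | n + 1 => addExp zero (tower n)

/-- `γ + ω^β · n`. -/
def addExpMul (γ β : OrdTerm) : ℕ → OrdTerm
  | 0 => γ
  | n + 1 => addExp (addExpMul γ β n) β

/-- The `n`-th element `λ_n` of the fundamental sequence of a limit term `λ`, that is, of a term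
`γ + ω^β` with `β ≠ 0`:  `(γ + ω^{δ+1})_n = γ + ω^δ · n`, and `(γ + ω^β)_n = γ + ω^{β_n}` if `β`
is a limit.  (On `0` and on successor terms `γ + ω^0` the value is irrelevant.) -/
def fund : OrdTerm → ℕ → OrdTerm
  | zero, _ => zero
  | addExp γ zero, _ => γ
  | addExp γ (addExp δ zero), n => addExpMul γ δ n
  | addExp γ (addExp δ (addExp ε ζ)), n => addExp γ (fund (addExp δ (addExp ε ζ)) n)

theorem toOrdinal_addExpMul_lt (γ δ : OrdTerm) (n : ℕ) :
    (addExpMul γ δ n).toOrdinal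
      < γ.toOrdinal + Ordinal.omega0 ^ (addExp δ zero).toOrdinal := by
  have h : ∀ n : ℕ, (addExpMul γ δ n).toOrdinal
      = γ.toOrdinal + Ordinal.omega0 ^ δ.toOrdinal * (n : Ordinal) := by
    intro n
    induction n with
    | zero => simp [addExpMul]
    | succ k ih => simp [addExpMul, toOrdinal, ih, mul_add, add_assoc]
  rw [h n]
  simp only [toOrdinal, Ordinal.opow_zero, Ordinal.opow_add, Ordinal.opow_one]
  gcongr
  · exact Ordinal.opow_pos _ Ordinal.omega0_pos
  · exact Ordinal.natCast_lt_omega0 n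

theorem toOrdinal_fund_lt : ∀ (γ β : OrdTerm) (n : ℕ),
    (fund (addExp γ β) n).toOrdinal < (addExp γ β).toOrdinal
  | γ, zero, n => by simp [fund, toOrdinal]
  | γ, addExp δ zero, n => by
      exact toOrdinal_addExpMul_lt γ δ n
  | γ, addExp δ (addExp ε ζ), n => by
      have ih := toOrdinal_fund_lt δ (addExp ε ζ) n
      simp only [fund]
      rw [toOrdinal, toOrdinal]
      have h := (Ordinal.opow_lt_opow_iff_right Ordinal.one_lt_omega0).2 ih
      gcongr

/-- The Hardy function `H^α : ℕ → ℕ` over the successor function: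
`H^0(n) = n`, `H^{α+1}(n) = H^α(n+1)`, and `H^λ(n) = H^{λ_n}(n)` for limit terms `λ`. -/
noncomputable def hardy : OrdTerm → ℕ → ℕ
  | zero, n => n
  | addExp γ zero, n => hardy γ (n + 1)
  | addExp γ (addExp δ ε), n => hardy (fund (addExp γ (addExp δ ε)) n) n
termination_by α => α.toOrdinal
decreasing_by
  · simp [toOrdinal]
  · exact toOrdinal_fund_lt γ (addExp δ ε) n

end OrdTerm

/-! ### Priority channel systems -/

/-- The two kinds of channel operations, `!` (write) and `?` (read). -/
inductive ChanOp : Type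
  | write
  | read

/-- Transition rules `(q, c, op, a, q')` of a level-`D` system with `m` channels and `k` states;
the level-`D` priority alphabet `{0, …, D}` is `Fin (D + 1)`. -/
abbrev PCSRule (D m k : ℕ) : Type :=
  Fin k × Fin m × ChanOp × Fin (D + 1) × Fin k

/-- A level-`D` priority channel system with `m` channels and finitely many control states
(numbered from `0`). -/
structure PCS (D m : ℕ) : Type where
  numStates : ℕ
  rules : Set (PCSRule D m numStates)

namespace PCS

variable {D m : ℕ}

/-- A configuration: a control state together with the contents of the `m` channels. -/
abbrev Conf (S : PCS D m) : Type :=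
  Fin S.numStates × (Fin m → List (Fin (D + 1)))

/-- One step of the write-superseding semantics.  A read removes the first message of the channel.
A write of `a` appends `a` at the end of the channel, after dropping some (possibly empty)
suffix that consists of messages of priority at most `a`. -/
inductive WStep (S : PCS D m) : S.Conf → S.Conf → Prop
  | read (q q' : Fin S.numStates) (i : Fin m) (a : Fin (D + 1))
      (X : Fin m → List (Fin (D + 1))) (y : List (Fin (D + 1)))
      (hrule : (q, i, ChanOp.read, a, q') ∈ S.rules)
      (hX : X i = a :: y) :
      WStep S (q, X) (q', Function.update X i y)
  | write (q q' : Fin S.numStates) (i : Fin m) (a : Fin (D + 1))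
      (X : Fin m → List (Fin (D + 1))) (z z' : List (Fin (D + 1)))
      (hrule : (q, i, ChanOp.write, a, q') ∈ S.rules)
      (hX : X i = z ++ z') (hz' : ∀ b ∈ z', b ≤ a) :
      WStep S (q, X) (q', Function.update X i (z ++ [a]))

/-- Runs of the write-superseding semantics. -/
def Reaches (S : PCS D m) : S.Conf → S.Conf → Prop :=
  Relation.ReflTransGen S.WStep

end PCS

/-! ### Codes of ordinal terms -/

/-- The language `P_{k-1}` of proper codes, over the alphabet `{0, …, D}` with `k ≤ D + 1`:
`P_{-1} = {ε}` and `P_a = (P_{a-1} a)^*`. -/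
def codeLang (D : ℕ) : ℕ → Language (Fin (D + 1))
  | 0 => 1
  | k + 1 => KStar.kstar (codeLang D k * ({[Fin.ofNat (D + 1) k]} : Language (Fin (D + 1))))

/-- The encoding function `s_{k-1}` on terms below `Ω_k`, over the alphabet `{0, …, D}` with
`k ≤ D + 1`:  `s_a(0) = ε` and `s_a(γ + ω^β) = s_a(γ) s_{a-1}(β) a`. -/
def encodeTerm (D : ℕ) : ℕ → OrdTerm → List (Fin (D + 1))
  | _, .zero => []
  | 0, .addExp _ _ => []
  | k + 1, .addExp γ β =>
      encodeTerm D (k + 1) γ ++ encodeTerm D k β ++ [Fin.ofNat (D + 1) k]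

/-! ### Weak Hardy computers -/

/-- A `(d+1)`-PCS with three channels and two distinguished states.  Channel `0` holds an ordinal,
channel `1` a counter, and channel `2` is the temporary storage. -/
structure HardyPCS (d : ℕ) : Type extends PCS (d + 1) 3 where
  pInit : Fin numStates
  pFinal : Fin numStates

namespace HardyPCS

variable {d : ℕ}

/-- Words over `{0, …, d + 1}`. -/
abbrev Word (d : ℕ) : Type := List (Fin (d + 1 + 1))

/-- The word `x $`, where the end marker `$` is the highest priority `d + 1`. -/
def mark (x : Word d) : Word d := x ++ [Fin.last (d + 1)]

/-- The words of `Σ_d^*`, i.e. those in which the marker `$ = d + 1` does not occur. -/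
def Unmarked (x : Word d) : Prop := Fin.last (d + 1) ∉ x

/-- The code `s(α) = s_d(α)` of a term `α < Ω_{d+1}`. -/
def ordCode (d : ℕ) (α : OrdTerm) : Word d := encodeTerm (d + 1) (d + 1) α

/-- The counter word `0^n`. -/
def counter (d n : ℕ) : Word d := List.replicate n 0

/-- `S` has a run `(p_init, x, y, z) →* (p_final, u, v, w)`. -/
def Computes (S : HardyPCS d) (x y z u v w : Word d) : Prop :=
  S.toPCS.Reaches (S.pInit, ![x, y, z]) (S.pFinal, ![u, v, w])

/-- Safety.  The channels initially hold `x $`, `y $`, `z $` with a single marker each. -/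
def Safe (S : HardyPCS d) : Prop :=
  ∀ x y z u v w : Word d, Unmarked x → Unmarked y → Unmarked z →
    S.Computes (mark x) (mark y) (mark z) u v w →
      x ∈ codeLang (d + 1) (d + 1) ∧ (∃ n : ℕ, 0 < n ∧ y = counter d n) ∧ z = [] ∧
      (∃ u', Unmarked u' ∧ u = mark u') ∧
      (∃ v', Unmarked v' ∧ v = mark v') ∧
      (∃ w', Unmarked w' ∧ w = mark w')

/-- Robustness. -/
def Robust (S : HardyPCS d) : Prop :=
  ∀ α β : OrdTerm, α < OrdTerm.tower (d + 1) → β < OrdTerm.tower (d + 1) → ∀ n m : ℕ,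
    S.Computes (mark (ordCode d α)) (mark (counter d n)) (mark [])
      (mark (ordCode d β)) (mark (counter d m)) (mark []) →
    β.hardy m ≤ α.hardy n

/-- Weak Hardy computers for `Ω_{d+1}`. -/
def IsWeakHardyComputer (S : HardyPCS d) : Prop := S.Safe ∧ S.Robust

/-- Completeness: `S` can compute `H^α(n)` exactly. -/
def IsComplete (S : HardyPCS d) : Prop :=
  ∀ α : OrdTerm, α < OrdTerm.tower (d + 1) → ∀ n : ℕ, 0 < n →
    S.Computes (mark (ordCode d α)) (mark (counter d n)) (mark [])
      (mark []) (mark (counter d (α.hardy n))) (mark [])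

/-- Inv-completeness: `S` can invert the computation of `H^α(n)`. -/
def IsInvComplete (S : HardyPCS d) : Prop :=
  ∀ α : OrdTerm, α < OrdTerm.tower (d + 1) → ∀ n : ℕ, 0 < n →
    S.Computes (mark []) (mark (counter d (α.hardy n))) (mark [])
      (mark (ordCode d α)) (mark (counter d n)) (mark [])

/-- A concrete finite description of a system: the number of states, the list of transition
rules (`true` for a write, `false` for a read), the initial and the final state. -/
abbrev Description : Type :=
  ℕ × List (ℕ × ℕ × Bool × ℕ × ℕ) × ℕ × ℕ

/-- The description of a single rule. -/
def describeRule {k : ℕ} : PCSRule (d + 1) 3 k → ℕ × ℕ × Bool × ℕ × ℕ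
  | (q, i, .write, a, q') => (q, i, true, a, q')
  | (q, i, .read, a, q') => (q, i, false, a, q')

/-- `c` is a description of `S`. -/
def DescribedBy (S : HardyPCS d) (c : Description) : Prop :=
  c.1 = S.numStates ∧
  (∀ r : ℕ × ℕ × Bool × ℕ × ℕ, r ∈ c.2.1 ↔ ∃ δ ∈ S.rules, describeRule δ = r) ∧
  c.2.2 = ((S.pInit : ℕ), (S.pFinal : ℕ))

/-- The family `(S_d)` is generated uniformly: an algorithm outputs a description of `S_d`
on input `d`. -/
def UniformlyGenerated (S : (d : ℕ) → HardyPCS d) : Prop :=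
  ∃ code : ℕ → Description, Computable code ∧ ∀ d : ℕ, (S d).DescribedBy (code d)

end HardyPCS

/-!
A single machine serves as `S_d` and as `S'_d`.  It repeatedly rewrites a pair `(α, n)`, given by
a code and a counter, by one of the rules `(γ + 1, n) → (γ, n + 1)` and `(λ, n) → (λ_n, n)` or by
one of their inverses.  Lossless rewriting preserves the value `H^α(n)` in both directions, so
rewriting `(α, n)` down to `(0, H^α(n))`, and back up again, gives completeness and
inv-completeness (`run_hardy`).

On codes, the rule for limits is `u v a (a+1) (a+2) … d ↔ u (v (a+1))^n (a+2) … d`, where `v` is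
the code of a term `δ` at level `a` (`enc_limit`).  Channels are rewritten by rotation: messages
are read at the front and written again at the end.

Robustness says that superseding cannot increase the value.  Since it may destroy codes, values
are assigned to arbitrary words: `decode` reads a word from left to right, keeping one term per
level. Deleting a letter in front of one that is at least as large yields a term that embeds
structurally (`Loss.supersede`), and the Hardy functions are monotone under this embedding for
positive arguments (`hardy_mono`), although they are not monotone in the denoted ordinals.  The
two rules for limits are sound on arbitrary words by `hardy_expand` and `hardy_contract`; the
latter requires the machine to check where `v` begins and ends.  `Edge.sound` collects these facts
into an invariant of all runs.  As the machine starts by verifying the input, which takes a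
bounded look at neighbouring letters (`mem_codeLang_of_isChain`), the same invariant gives safety.

The machine is presented by edges between finitely many kinds of phases, labelled with lists of
operations.  The states within an edge are the remaining operations together with the target,
numbered by their encodings, so that the list of rules is primitive recursive in `d`
(`primrec_rules`).
-/

/-! ### Embedding of terms and monotonicity of the Hardy functions -/

namespace OrdTerm

/-- The structural embedding of terms: `γ + ω^β` embeds into `γ' + ω^β'` when `γ` embeds into `γ'`
and `β` into `β'`, and summands may be left out.  Unlike the comparison of the denoted ordinals,
it makes the Hardy functions monotone in their index. -/
inductive Emb : OrdTerm → OrdTerm → Prop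
  | zero (α : OrdTerm) : Emb zero α
  | cons {γ γ' β β' : OrdTerm} : Emb γ γ' → Emb β β' → Emb (addExp γ β) (addExp γ' β')
  | drop {α γ' : OrdTerm} (β' : OrdTerm) : Emb α γ' → Emb α (addExp γ' β')

namespace Emb

theorem refl : ∀ α : OrdTerm, Emb α α
  | .zero => .zero _
  | .addExp γ β => .cons (refl γ) (refl β)

theorem trans {α β γ : OrdTerm} (h₁ : Emb α β) (h₂ : Emb β γ) : Emb α γ := by
  induction h₂ generalizing α with
  | zero => cases h₁; exact .zero _
  | cons _ _ ih₁ ih₂ =>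
    cases h₁ with
    | zero => exact .zero _
    | cons h h' => exact .cons (ih₁ h) (ih₂ h')
    | drop _ h => exact .drop _ (ih₁ h)
  | drop _ _ ih => exact .drop _ (ih h₁)

theorem addExpMul_right {α γ : OrdTerm} (h : Emb α γ) (δ : OrdTerm) :
    ∀ n, Emb α (addExpMul γ δ n)
  | 0 => h
  | n + 1 => .drop _ (addExpMul_right h δ n)

theorem addExpMul {γ γ' δ δ' : OrdTerm} (hγ : Emb γ γ') (hδ : Emb δ δ') {n n' : ℕ}
    (h : n ≤ n') : Emb (OrdTerm.addExpMul γ δ n) (OrdTerm.addExpMul γ' δ' n') := by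
  induction h with
  | refl => induction n with
    | zero => exact hγ
    | succ n ih => exact .cons ih hδ
  | step _ ih => exact .drop _ ih

theorem addExp_addExpMul {γ γ' δ δ' : OrdTerm} (hγ : Emb γ γ') (hδ : Emb δ δ') {n : ℕ}
    (h : 1 ≤ n) : Emb (addExp γ δ) (OrdTerm.addExpMul γ' δ' n) :=
  addExpMul (n := 1) hγ hδ h

/-- Anything that embeds into a limit term embeds into an element of its fundamental sequence, or
is a limit term whose own fundamental sequence embeds there. -/
theorem fund {γ' : OrdTerm} : ∀ {β' α : OrdTerm} {n n' : ℕ}, β' ≠ .zero →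
    Emb α (addExp γ' β') → n ≤ n' → 1 ≤ n' →
    Emb α (OrdTerm.fund (addExp γ' β') n') ∨
      ∃ γ δ ε, α = addExp γ (addExp δ ε) ∧
        Emb (OrdTerm.fund α n) (OrdTerm.fund (addExp γ' β') n')
  | .zero, _, _, _, h0, _, _, _ => absurd rfl h0
  | .addExp δ' .zero, α, n, n', _, h, hn, h1 => by
    cases h with
    | zero => exact .inl (.zero _)
    | drop _ h => exact .inl (addExpMul_right h _ _)
    | cons hγ hβ =>
      cases hβ with
      | zero => exact .inl (addExp_addExpMul hγ (.zero _) h1)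
      | drop _ hβ => exact .inl (addExp_addExpMul hγ hβ h1)
      | cons hδ hε =>
        cases hε
        exact .inr ⟨_, _, _, rfl, addExpMul hγ hδ hn⟩
  | .addExp δ' (.addExp ε' ζ'), α, n, n', _, h, hn, h1 => by
    cases h with
    | zero => exact .inl (.zero _)
    | drop _ h => exact .inl (.drop _ h)
    | cons hγ hβ =>
      rcases fund (β' := .addExp ε' ζ') (n := n) (by simp) hβ hn h1 with h | ⟨γ, δ, ε, rfl, h⟩
      · exact .inl (.cons hγ h)
      · exact .inr ⟨_, _, _, rfl, .cons hγ h⟩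

end Emb

theorem hardy_zero (n : ℕ) : hardy zero n = n := by rw [hardy]

theorem hardy_addExp_zero (γ : OrdTerm) (n : ℕ) :
    hardy (addExp γ zero) n = hardy γ (n + 1) := by rw [hardy]

theorem hardy_limit (γ : OrdTerm) {β : OrdTerm} (h : β ≠ zero) (n : ℕ) :
    hardy (addExp γ β) n = hardy (fund (addExp γ β) n) n := by
  cases β with
  | zero => exact absurd rfl h
  | addExp => rw [hardy]

/-- Monotonicity of the Hardy functions.  The restriction `1 ≤ n'` is needed: `1` embeds into `ω`,
but `H^ω(0) = 0 < 1 = H^1(0)`. -/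
theorem hardy_mono {α α' : OrdTerm} (h : Emb α α') {n n' : ℕ} (hn : n ≤ n') (h1 : 1 ≤ n') :
    hardy α n ≤ hardy α' n' := by
  induction hα : α'.toOrdinal using WellFoundedLT.induction generalizing α α' n n' with
  | ind o ih =>
    subst hα
    cases α' with
    | zero => cases h; simpa [hardy_zero] using hn
    | addExp γ' β' =>
      by_cases hβ : β' = .zero
      · subst hβ
        have hlt : γ'.toOrdinal < (addExp γ' .zero).toOrdinal := by simp [toOrdinal]
        rw [hardy_addExp_zero]
        cases h with
        | zero => exact ih _ hlt (.zero _) (by omega) (by omega) rfl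
        | drop _ h => exact ih _ hlt h (by omega) (by omega) rfl
        | cons hγ hβ =>
          cases hβ
          rw [hardy_addExp_zero]
          exact ih _ hlt hγ (by omega) (by omega) rfl
      · rw [hardy_limit γ' hβ]
        have hlt := toOrdinal_fund_lt γ' β' n'
        rcases Emb.fund hβ h hn h1 with h | ⟨γ, δ, ε, rfl, h⟩
        · exact ih _ hlt h hn h1 rfl
        · rw [hardy_limit γ (by simp)]
          exact ih _ hlt h hn h1 rfl

end OrdTerm

/-! ### Words as terms -/

namespace HardyWord

open OrdTerm

/-- The term held one level below `a`, which is `0` for `a = 0`. -/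
def below (f : ℕ → OrdTerm) : ℕ → OrdTerm
  | 0 => .zero
  | a + 1 => f a

/-- Reading a word from left to right keeps one term per level.  The letter `a` turns the term
`β` of level `a - 1` into a summand `ω^β` at level `a` and clears all lower levels. -/
def push (f : ℕ → OrdTerm) (a : ℕ) : ℕ → OrdTerm := fun b =>
  if b < a then .zero else if b = a then .addExp (f a) (below f a) else f b

/-- The levels reached from `f` by reading the word `x`. -/
def levels (f : ℕ → OrdTerm) (x : List ℕ) : ℕ → OrdTerm := x.foldl push f

/-- The term denoted by an arbitrary word over `{0, …, d}`.  It inverts the encoding on codes;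
on other words, a trailing part that no letter `d` closes is ignored. -/
def decode (d : ℕ) (x : List ℕ) : OrdTerm := levels (fun _ => .zero) x d

@[simp] theorem levels_nil (f : ℕ → OrdTerm) : levels f [] = f := rfl

@[simp] theorem levels_cons (f : ℕ → OrdTerm) (a : ℕ) (x : List ℕ) :
    levels f (a :: x) = levels (push f a) x := rfl

@[simp] theorem levels_append (f : ℕ → OrdTerm) (x y : List ℕ) :
    levels f (x ++ y) = levels (levels f x) y := List.foldl_append

theorem push_lt {f : ℕ → OrdTerm} {a b : ℕ} (h : b < a) : push f a b = .zero := if_pos h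

theorem push_self (f : ℕ → OrdTerm) (a : ℕ) : push f a a = .addExp (f a) (below f a) := by
  simp [push]

theorem push_gt {f : ℕ → OrdTerm} {a b : ℕ} (h : a < b) : push f a b = f b := by
  simp [push, h.ne', h.not_gt]

theorem levels_of_lt {a b : ℕ} (h : a < b) {x : List ℕ} (hx : ∀ c ∈ x, c ≤ a)
    (f : ℕ → OrdTerm) : levels f x b = f b := by
  induction x generalizing f with
  | nil => rfl
  | cons c x ih =>
    rw [levels_cons, ih (fun c hc => hx c (by simp [hc])), push_gt]
    exact (hx c (by simp)).trans_lt h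

/-- A relation between terms that `0` and `γ + ω^β` respect is respected by reading a word, and
this holds for any initial segment of the levels by itself. -/
theorem levels_rel {R : OrdTerm → OrdTerm → Prop} (h0 : R .zero .zero)
    (hR : ∀ {γ γ' β β'}, R γ γ' → R β β' → R (.addExp γ β) (.addExp γ' β')) {m : ℕ}
    (x : List ℕ) {f g : ℕ → OrdTerm} (h : ∀ b ≤ m, R (f b) (g b)) :
    ∀ b ≤ m, R (levels f x b) (levels g x b) := by
  induction x generalizing f g with
  | nil => exact h
  | cons a x ih =>
    refine ih fun b hb => ?_
    unfold push
    split_ifs with h₁ h₂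
    · exact h0
    · subst h₂
      refine hR (h _ hb) ?_
      cases b with
      | zero => exact h0
      | succ b => exact h b (by omega)
    · exact h b hb

theorem levels_emb_of_le {m : ℕ} (x : List ℕ) {f g : ℕ → OrdTerm}
    (h : ∀ b ≤ m, Emb (f b) (g b)) : ∀ b ≤ m, Emb (levels f x b) (levels g x b) :=
  levels_rel (.zero _) .cons x h

theorem levels_emb (x : List ℕ) {f g : ℕ → OrdTerm} (h : ∀ b, Emb (f b) (g b)) (b : ℕ) :
    Emb (levels f x b) (levels g x b) :=
  levels_emb_of_le x (fun b _ => h b) b le_rfl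

theorem levels_congr_of_le {m : ℕ} (x : List ℕ) {f g : ℕ → OrdTerm}
    (h : ∀ b ≤ m, f b = g b) : ∀ b ≤ m, levels f x b = levels g x b :=
  levels_rel rfl (by rintro _ _ _ _ rfl rfl; rfl) x h

/-! ### Superseded messages -/

/-- `Loss x' x`: in every context, replacing `x` by `x'` can only shrink the denoted term. -/
def Loss (x' x : List ℕ) : Prop :=
  ∀ f f' : ℕ → OrdTerm, (∀ b, Emb (f b) (f' b)) → ∀ b, Emb (levels f x' b) (levels f' x b)

namespace Loss

theorem refl (x : List ℕ) : Loss x x := fun _ _ h => levels_emb x h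

theorem append {x' x y' y : List ℕ} (hx : Loss x' x) (hy : Loss y' y) :
    Loss (x' ++ y') (x ++ y) := by
  intro f f' h
  simpa using hy _ _ (hx f f' h)

theorem trans {x y z : List ℕ} (h₁ : Loss x y) (h₂ : Loss y z) : Loss x z :=
  fun _ _ h b => (h₁ _ _ h b).trans (h₂ _ _ (fun _ => .refl _) b)

theorem append_left (w : List ℕ) {x y : List ℕ} (h : Loss x y) : Loss (w ++ x) (w ++ y) :=
  (refl w).append h

theorem append_right (w : List ℕ) {x y : List ℕ} (h : Loss x y) : Loss (x ++ w) (y ++ w) :=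
  h.append (refl w)

theorem flatten_replicate {x y : List ℕ} (h : Loss x y) :
    ∀ n, Loss (List.replicate n x).flatten (List.replicate n y).flatten
  | 0 => refl _
  | n + 1 => by
    simpa [List.replicate_succ] using h.append (flatten_replicate h n)

/-- Deleting a letter in front of one that is at least as large. -/
theorem push_push {a b : ℕ} (h : b ≤ a) (f : ℕ → OrdTerm) (c : ℕ) :
    Emb (push f a c) (push (push f b) a c) := by
  rcases lt_trichotomy c a with hc | rfl | hc
  · rw [push_lt hc]; exact .zero _
  · rw [push_self, push_self]
    rcases h.lt_or_eq with h | rfl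
    · rw [push_gt h]
      refine .cons (.refl _) ?_
      cases c with
      | zero => exact .zero _
      | succ c =>
        rcases (Nat.lt_succ_iff.1 h).lt_or_eq with h | rfl
        · rw [below, below, push_gt h]; exact .refl _
        · rw [below, below, push_self]; exact .drop _ (.refl _)
    · rw [push_self]; exact .drop _ (.refl _)
  · rw [push_gt hc, push_gt hc, push_gt (h.trans_lt hc)]; exact .refl _

/-- The effect of a superseding write: the messages `z ≤ a` in front of `a` are dropped. -/
theorem supersede {z : List ℕ} {a : ℕ} (h : ∀ b ∈ z, b ≤ a) : Loss [a] (z ++ [a]) := by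
  induction z using List.reverseRecOn with
  | nil => exact refl _
  | append_singleton z b ih =>
    have key : Loss [a] [b, a] := fun f f' hf c =>
      (levels_emb [a] hf c).trans (push_push (h b (by simp)) f' c)
    simpa using (ih fun c hc => h c (by simp [hc])).trans (key.append_left z)

theorem supersede_append {z : List ℕ} {a : ℕ} (h : ∀ b ∈ z, b ≤ a) (w y : List ℕ) :
    Loss (w ++ a :: y) (w ++ z ++ a :: y) := by
  simpa using (refl w).append ((supersede h).append (refl y))

end Loss

theorem Loss.decode {d : ℕ} {x y : List ℕ} (h : Loss x y) : Emb (decode d x) (decode d y) :=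
  h _ _ (fun _ => .refl _) d

/-- Dropping the end of a word shrinks the denoted term. -/
theorem decode_append_emb {d : ℕ} {z : List ℕ} (hz : ∀ b ∈ z, b ≤ d) (x : List ℕ) :
    Emb (decode d x) (decode d (x ++ z)) := by
  unfold decode
  rw [levels_append]
  generalize levels _ x = f
  induction z generalizing f with
  | nil => exact .refl _
  | cons b z ih =>
    refine Emb.trans ?_ (ih (fun c hc => hz c (by simp [hc])) _)
    rcases (hz b (by simp)).lt_or_eq with h | rfl
    · rw [push_gt h]; exact .refl _
    · rw [push_self]; exact .drop _ (.refl _)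

/-! ### Fundamental sequences on words -/

/-- The word `(e + 1) (e + 2) … d`. -/
def tail (d e : ℕ) : List ℕ := List.range' (e + 1) (d - e)

@[simp] theorem tail_self (d : ℕ) : tail d d = [] := by simp [tail]

theorem tail_of_lt {d e : ℕ} (h : e < d) : tail d e = (e + 1) :: tail d (e + 1) := by
  obtain ⟨k, rfl⟩ := Nat.exists_eq_add_of_lt h
  simp [tail, show e + k + 1 - e = k + 1 by omega, show e + k + 1 - (e + 1) = k by omega,
    List.range'_succ]

theorem tail_succ_right {d e : ℕ} (h : e ≤ d) : tail (d + 1) e = tail d e ++ [d + 1] := by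
  obtain ⟨k, rfl⟩ := Nat.exists_eq_add_of_le h
  simp [tail, show e + k + 1 - e = k + 1 by omega, List.range'_concat, add_comm, add_left_comm]
  omega

/-- The letters `e + 1, …, d` wrap the term of level `e` into exponents, so that a fundamental
sequence at level `e` becomes one at level `d`. -/
theorem hardy_levels_tail {d n : ℕ} : ∀ (k : ℕ) {e : ℕ}, e + k = d → ∀ {f g : ℕ → OrdTerm},
    (∀ b, e < b → f b = g b) → (∃ γ δ ε, f e = .addExp γ (.addExp δ ε)) → g e = fund (f e) n →
    hardy (levels f (tail d e) d) n = hardy (levels g (tail d e) d) n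
  | 0, e, h, f, g, _, ⟨γ, δ, ε, hf⟩, hg => by
    obtain rfl : e = d := by omega
    simp only [tail_self, levels_nil, hg]
    rw [hf, hardy_limit _ (by simp)]
  | k + 1, e, h, f, g, hfg, ⟨γ, δ, ε, hf⟩, hg => by
    rw [tail_of_lt (by omega)]
    refine hardy_levels_tail k (by omega) (fun b hb => ?_) ⟨f (e + 1), γ, .addExp δ ε, ?_⟩ ?_
    · rw [push_gt hb, push_gt hb, hfg b (by omega)]
    · rw [push_self, below, hf]
    · rw [push_self, push_self, below, below, hf, ← hfg _ (by omega), hg, hf]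
      rfl

/-- All levels up to `a` hold `0`. -/
def Clean (f : ℕ → OrdTerm) (a : ℕ) : Prop := ∀ b ≤ a, f b = .zero

theorem clean_levels_concat (f : ℕ → OrdTerm) (x : List ℕ) {a l : ℕ} (h : a + 1 ≤ l) :
    Clean (levels f (x ++ [l])) a := by
  intro b hb
  simpa using push_lt (show b < l by omega)

theorem below_levels_eq_zero {f : ℕ → OrdTerm} {a : ℕ} (hf : Clean f a) {v : List ℕ}
    (hv : v = [] ∨ ∃ v', v = v' ++ [a]) : below (levels f v) a = .zero := by
  rcases a with _ | a
  · rfl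
  · rcases hv with rfl | ⟨v', rfl⟩
    · exact hf _ (by omega)
    · simpa [below] using push_lt (Nat.lt_succ_self a)

/-- `n` copies of the code `v` of `δ`, each closed by the letter `a + 1`, append `ω^δ · n` at
level `a + 1`. -/
theorem levels_replicate {f : ℕ → OrdTerm} {a : ℕ} (hf : Clean f a) {v : List ℕ}
    (hv : ∀ c ∈ v, c ≤ a) (n : ℕ) :
    Clean (levels f (List.replicate n (v ++ [a + 1])).flatten) a ∧
      levels f (List.replicate n (v ++ [a + 1])).flatten (a + 1)
        = addExpMul (f (a + 1)) (levels f v a) n ∧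
      ∀ b, a + 1 < b → levels f (List.replicate n (v ++ [a + 1])).flatten b = f b := by
  induction n with
  | zero => exact ⟨hf, rfl, fun _ _ => rfl⟩
  | succ n ih =>
    obtain ⟨h₁, h₂, h₃⟩ := ih
    rw [List.replicate_succ', List.flatten_append]
    simp only [levels_append, List.flatten_cons, List.flatten_nil, levels_cons, levels_nil]
    refine ⟨fun b hb => push_lt (by omega), ?_, fun b hb => ?_⟩
    · rw [push_self, levels_of_lt (Nat.lt_succ_self a) hv, h₂, below,
        levels_congr_of_le v (fun b hb => (h₁ b hb).trans (hf b hb).symm) a le_rfl]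
      rfl
    · rw [push_gt hb, levels_of_lt (by omega) hv, h₃ b hb]

/-- A version of `levels_replicate` for arbitrary `f`: only the first copy of `v` can meet leftovers
at the levels up to `a`, so the result stays below `n` copies of that first exponent. -/
theorem levels_replicate_emb (f : ℕ → OrdTerm) {a : ℕ} {v : List ℕ}
    (hv : ∀ c ∈ v, c ≤ a) (n : ℕ) :
    Clean (levels f (List.replicate (n + 1) (v ++ [a + 1])).flatten) a ∧
      Emb (levels f (List.replicate (n + 1) (v ++ [a + 1])).flatten (a + 1))
        (addExpMul (f (a + 1)) (levels f v a) (n + 1)) ∧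
      ∀ b, a + 1 < b → levels f (List.replicate (n + 1) (v ++ [a + 1])).flatten b = f b := by
  induction n with
  | zero =>
    simp only [Nat.reduceAdd, List.replicate_one, List.flatten_cons, List.flatten_nil,
      levels_append, levels_cons, levels_nil]
    refine ⟨fun b hb => push_lt (by omega), ?_, fun b hb => ?_⟩
    · rw [push_self, levels_of_lt (Nat.lt_succ_self a) hv]
      exact .refl _
    · rw [push_gt hb, levels_of_lt (by omega) hv]
  | succ n ih =>
    obtain ⟨h₁, h₂, h₃⟩ := ih
    rw [List.replicate_succ', List.flatten_append]
    simp only [levels_append, List.flatten_cons, List.flatten_nil, levels_cons, levels_nil]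
    refine ⟨fun b hb => push_lt (by omega), ?_, fun b hb => ?_⟩
    · rw [push_self, levels_of_lt (Nat.lt_succ_self a) hv, below]
      refine .cons h₂ (levels_emb_of_le v (fun b hb => ?_) a le_rfl)
      rw [h₁ b hb]; exact .zero _
    · rw [push_gt hb, levels_of_lt (by omega) hv, h₃ b hb]

/-- The levels after a limit term `ω^(δ + 1)` has been written at level `a + 1`. -/
theorem levels_limit (f : ℕ → OrdTerm) {a : ℕ} {v : List ℕ} (hv : ∀ c ∈ v, c ≤ a) :
    levels f (v ++ [a, a + 1]) (a + 1)
        = .addExp (f (a + 1)) (.addExp (levels f v a) (below (levels f v) a)) ∧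
      ∀ b, a + 1 < b → levels f (v ++ [a, a + 1]) b = f b := by
  simp only [levels_append, levels_cons, levels_nil]
  refine ⟨?_, fun b hb => ?_⟩
  · rw [push_self, push_gt (Nat.lt_succ_self a), levels_of_lt (Nat.lt_succ_self a) hv, below,
      push_self]
  · rw [push_gt hb, push_gt (by omega), levels_of_lt (by omega) hv]

/-- A code of `λ` and the corresponding code of `λ_n` have the same value at `n`, provided that `w`
and `v` end where a code would be cut. -/
theorem hardy_contract {d a n : ℕ} (ha : a < d) {w v : List ℕ}
    (hw : Clean (levels (fun _ => .zero) w) a) (hv : ∀ c ∈ v, c ≤ a)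
    (hva : v = [] ∨ ∃ v', v = v' ++ [a]) :
    hardy (decode d (w ++ v ++ [a, a + 1] ++ tail d (a + 1))) n
      = hardy (decode d (w ++ (List.replicate n (v ++ [a + 1])).flatten ++ tail d (a + 1))) n := by
  unfold decode
  rw [List.append_assoc w v, levels_append _ (w ++ _), levels_append _ w, levels_append _ (w ++ _),
    levels_append _ w]
  obtain ⟨h₁, h₂⟩ := levels_limit (levels (fun _ => .zero) w) hv
  obtain ⟨-, h₃, h₄⟩ := levels_replicate hw hv n
  rw [below_levels_eq_zero hw hva] at h₁
  refine hardy_levels_tail (d - (a + 1)) (show a + 1 + (d - (a + 1)) = d by omega)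
    (fun b hb => ?_) ⟨_, _, _, h₁⟩ ?_
  · rw [h₂ b hb, h₄ b hb]
  · rw [h₁, h₃]; rfl

/-- Without the cleanness conditions of `hardy_contract`, one inequality remains. -/
theorem hardy_expand {d a n : ℕ} (ha : a < d) (w : List ℕ) {v : List ℕ}
    (hv : ∀ c ∈ v, c ≤ a) (hn : 1 ≤ n) :
    hardy (decode d (w ++ (List.replicate n (v ++ [a + 1])).flatten ++ tail d (a + 1))) n
      ≤ hardy (decode d (w ++ v ++ [a, a + 1] ++ tail d (a + 1))) n := by
  unfold decode
  rw [List.append_assoc w v, levels_append _ (w ++ _), levels_append _ w, levels_append _ (w ++ _),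
    levels_append _ w]
  generalize levels (fun _ => OrdTerm.zero) w = f
  obtain ⟨h₁, h₂⟩ := levels_limit f hv
  obtain ⟨n, rfl⟩ := Nat.exists_eq_add_of_le' hn
  obtain ⟨h₃, h₄, h₅⟩ := levels_replicate_emb f hv n
  -- The word on the left lies below the `n`-th element of a limit term with exponent `δ + 1`,
  -- which in turn lies below the term on the right.
  set δ := levels f v a
  let g (τ : OrdTerm) : ℕ → OrdTerm := fun b =>
    if b ≤ a then .zero else if b = a + 1 then τ else f b
  have g_lt {τ} {b : ℕ} (hb : b ≤ a) : g τ b = .zero := by simp [g, hb]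
  have g_self {τ} : g τ (a + 1) = τ := by simp [g]
  have g_gt {τ} {b : ℕ} (hb : a + 1 < b) : g τ b = f b := by
    simp [g, hb.ne', show ¬ b ≤ a by omega]
  have key := hardy_levels_tail (n := n + 1) (d - (a + 1)) (show a + 1 + (d - (a + 1)) = d by omega)
    (f := g (.addExp (f (a + 1)) (.addExp δ .zero))) (g := g (addExpMul (f (a + 1)) δ (n + 1)))
    (fun b hb => by rw [g_gt hb, g_gt hb]) ⟨_, _, _, g_self⟩ (by rw [g_self, g_self]; rfl)
  refine (hardy_mono (levels_emb _ (fun b => ?_) d) le_rfl hn).trans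
    (key.ge.trans (hardy_mono (levels_emb _ (fun b => ?_) d) le_rfl hn))
  · rcases lt_trichotomy b (a + 1) with hb | rfl | hb
    · rw [h₃ b (by omega)]; exact .zero _
    · rw [g_self]; exact h₄
    · rw [g_gt hb, h₅ b hb]; exact .refl _
  · rcases lt_trichotomy b (a + 1) with hb | rfl | hb
    · rw [g_lt (Nat.lt_succ_iff.1 hb)]; exact .zero _
    · rw [g_self, h₁]; exact .cons (.refl _) (.cons (.refl _) (.zero _))
    · rw [g_gt hb, h₂ b hb]; exact .refl _

theorem decode_concat (d : ℕ) (x : List ℕ) : decode d (x ++ [d])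
    = .addExp (decode d x) (below (levels (fun _ => .zero) x) d) := by
  simp only [decode, levels_append, levels_cons, levels_nil, push_self]

/-- The final letter `d` may close more than `ω^0`, so there is only an inequality. -/
theorem hardy_pop (d : ℕ) (x : List ℕ) {n : ℕ} (hn : 1 ≤ n) :
    hardy (decode d x) (n + 1) ≤ hardy (decode d (x ++ [d])) n := by
  rw [decode_concat, ← hardy_addExp_zero]
  exact hardy_mono (.cons (.refl _) (.zero _)) le_rfl hn

theorem hardy_push (d : ℕ) {x : List ℕ} (hx : x = [] ∨ ∃ x', x = x' ++ [d]) (n : ℕ) :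
    hardy (decode d (x ++ [d])) n = hardy (decode d x) (n + 1) := by
  rw [decode_concat, below_levels_eq_zero (fun _ _ => rfl) hx, hardy_addExp_zero]

end HardyWord

/-! ### Codes -/

namespace HardyWord

open OrdTerm

/-- The code `s_{k-1}(α)` over the alphabet `ℕ`. -/
def enc : ℕ → OrdTerm → List ℕ
  | _, .zero => []
  | 0, .addExp _ _ => []
  | k + 1, .addExp γ β => enc (k + 1) γ ++ enc k β ++ [k]

/-- `Fits k α` is the structural form of `α < Ω_k`. -/
def Fits : ℕ → OrdTerm → Prop
  | _, .zero => True
  | 0, .addExp _ _ => False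
  | k + 1, .addExp γ β => Fits (k + 1) γ ∧ Fits k β

theorem fits_zero (k : ℕ) : Fits k .zero := by cases k <;> trivial

@[simp] theorem enc_zero (k : ℕ) : enc k .zero = [] := by cases k <;> rfl

theorem fits_of_lt : ∀ (k : ℕ) (α : OrdTerm), α < tower k → Fits k α
  | k, .zero, _ => fits_zero k
  | 0, .addExp γ β, h => by
    have h : γ.toOrdinal + Ordinal.omega0 ^ β.toOrdinal < 0 + Ordinal.omega0 ^ (0 : Ordinal) := h
    rw [Ordinal.opow_zero, zero_add, Order.lt_one_iff] at h
    have := (le_add_self.trans h.le).trans_lt (Ordinal.opow_pos β.toOrdinal Ordinal.omega0_pos)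
    exact absurd this (lt_irrefl _)
  | k + 1, .addExp γ β, h => by
    have h : γ.toOrdinal + Ordinal.omega0 ^ β.toOrdinal
      < 0 + Ordinal.omega0 ^ (tower k).toOrdinal := h
    refine ⟨fits_of_lt (k + 1) γ ?_, fits_of_lt k β ?_⟩
    · exact le_self_add.trans_lt h
    · rw [zero_add] at h
      exact (Ordinal.opow_lt_opow_iff_right Ordinal.one_lt_omega0).1 (le_add_self.trans_lt h)

theorem lt_of_mem_enc : ∀ {k : ℕ} {α : OrdTerm} {b : ℕ}, b ∈ enc k α → b < k
  | k, .zero, b, h => by simp at h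
  | 0, .addExp _ _, b, h => by simp [enc] at h
  | k + 1, .addExp γ β, b, h => by
    simp only [enc, List.mem_append, List.mem_singleton] at h
    rcases h with (h | h) | rfl
    · exact lt_of_mem_enc h
    · exact (lt_of_mem_enc h).trans (Nat.lt_succ_self k)
    · exact Nat.lt_succ_self _

theorem enc_eq_nil_or (k : ℕ) (α : OrdTerm) :
    enc (k + 1) α = [] ∨ ∃ x, enc (k + 1) α = x ++ [k] := by
  cases α with
  | zero => simp
  | addExp γ β => exact .inr ⟨_, rfl⟩

theorem levels_enc : ∀ {k : ℕ} {α : OrdTerm}, Fits (k + 1) α → ∀ {f : ℕ → OrdTerm}, Clean f k →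
    levels f (enc (k + 1) α) k = α ∧ ∀ b < k, levels f (enc (k + 1) α) b = .zero
  | k, .zero, _, f, hf => by simpa using ⟨hf k le_rfl, fun b hb => hf b hb.le⟩
  | k, .addExp γ β, ⟨hγ, hβ⟩, f, hf => by
    obtain ⟨h₁, h₂⟩ := levels_enc hγ hf
    simp only [enc, levels_append, levels_cons, levels_nil]
    refine ⟨?_, fun b hb => push_lt hb⟩
    rw [push_self]
    cases k with
    | zero =>
      cases β with
      | zero => simp [h₁, below]
      | addExp => exact hβ.elim
    | succ k =>
      rw [levels_of_lt (Nat.lt_succ_self k) (fun c hc => Nat.lt_succ_iff.1 (lt_of_mem_enc hc)), h₁,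
        below, (levels_enc hβ (fun b hb => h₂ b (by omega))).1]

theorem decode_enc {d : ℕ} {α : OrdTerm} (h : Fits (d + 1) α) : decode d (enc (d + 1) α) = α :=
  (levels_enc h fun _ _ => rfl).1

/-- The letter `b` may follow `a` in a code.  A word `x` over `{0, …, d}` belongs to `P_d` exactly
if all neighbours in `x (d + 1)` are related in this way, which a reader can check with one letter
of memory. -/
def StepLe (a b : ℕ) : Prop := b ≤ a + 1

theorem isChain_enc : ∀ {k : ℕ} {α : OrdTerm}, Fits k α → List.IsChain StepLe (enc k α ++ [k])
  | k, .zero, _ => by simp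
  | 0, .addExp _ _, h => h.elim
  | k + 1, .addExp γ β, ⟨hγ, hβ⟩ => by
    have h₁ := isChain_enc hγ
    have h₂ := isChain_enc hβ
    simp only [enc, List.append_assoc, List.isChain_append]
    rw [List.isChain_append] at h₁ h₂
    refine ⟨h₁.1, ⟨h₂.1, by simp [StepLe], by simpa [StepLe] using h₂.2.2⟩, ?_⟩
    intro x hx y hy
    have hk : k + 1 ≤ x + 1 := h₁.2.2 x hx (k + 1) (by simp)
    have hy' : y ∈ enc k β ++ [k] := List.mem_of_mem_head? (by simpa using hy)
    simp only [List.mem_append, List.mem_singleton] at hy'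
    have : y ≤ k := by
      rcases hy' with h | rfl
      · exact (lt_of_mem_enc h).le
      · exact le_rfl
    unfold StepLe
    omega

theorem enc_addExpMul (k : ℕ) (γ δ : OrdTerm) (n : ℕ) : enc (k + 1) (addExpMul γ δ n)
    = enc (k + 1) γ ++ (List.replicate n (enc k δ ++ [k])).flatten := by
  induction n with
  | zero => simp [addExpMul]
  | succ n ih => simp [addExpMul, enc, ih, List.replicate_succ', List.flatten_append]

/-- The code of a limit term and those of its fundamental sequence. -/
theorem enc_limit : ∀ {k : ℕ} {γ δ ε : OrdTerm}, Fits (k + 1) (.addExp γ (.addExp δ ε)) →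
    ∃ (u v : List ℕ) (a : ℕ), a < k ∧ (∀ c ∈ v, c ≤ a) ∧ (v = [] ∨ ∃ v', v = v' ++ [a]) ∧
      (u = [] ∨ ∃ u' l, u = u' ++ [l] ∧ a + 1 ≤ l) ∧
      enc (k + 1) (.addExp γ (.addExp δ ε)) = u ++ v ++ [a, a + 1] ++ tail k (a + 1) ∧
      ∀ n, enc (k + 1) (fund (.addExp γ (.addExp δ ε)) n)
        = u ++ (List.replicate n (v ++ [a + 1])).flatten ++ tail k (a + 1)
  | 0, _, _, _, h => h.2.elim
  | k + 1, γ, δ, .zero, _ => by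
    refine ⟨enc (k + 2) γ, enc (k + 1) δ, k, Nat.lt_succ_self k,
      fun c hc => Nat.lt_succ_iff.1 (lt_of_mem_enc hc), enc_eq_nil_or k δ, ?_, ?_, fun n => ?_⟩
    · rcases enc_eq_nil_or (k + 1) γ with h | ⟨x, h⟩
      · exact .inl h
      · exact .inr ⟨x, k + 1, h, le_rfl⟩
    · simp [enc]
    · rw [fund, enc_addExpMul]; simp
  | k + 1, γ, δ, .addExp ε ζ, h => by
    obtain ⟨u, v, a, ha, hv, hva, hu, he, hf⟩ := enc_limit h.2
    refine ⟨enc (k + 2) γ ++ u, v, a, by omega, hv, hva, ?_, ?_, fun n => ?_⟩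
    · rcases hu with rfl | ⟨u', l, rfl, hl⟩
      · rcases enc_eq_nil_or (k + 1) γ with h | ⟨x, h⟩
        · exact .inl (by simp [h])
        · exact .inr ⟨x, k + 1, by simp [h], by omega⟩
      · exact .inr ⟨enc (k + 2) γ ++ u', l, by simp, hl⟩
    · rw [enc, he, tail_succ_right (by omega)]; simp
    · rw [fund, enc, hf n, tail_succ_right (by omega)]; simp

theorem map_ofNat_enc (D : ℕ) : ∀ (k : ℕ) (α : OrdTerm),
    (enc k α).map (Fin.ofNat (D + 1)) = encodeTerm D k α
  | k, .zero => by cases k <;> rfl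
  | 0, .addExp _ _ => rfl
  | k + 1, .addExp γ β => by
    simp [enc, encodeTerm, map_ofNat_enc D (k + 1) γ, map_ofNat_enc D k β]

theorem map_val_encodeTerm {D : ℕ} : ∀ {k : ℕ} (α : OrdTerm), k ≤ D + 1 →
    (encodeTerm D k α).map Fin.val = enc k α
  | k, .zero, _ => by cases k <;> rfl
  | 0, .addExp _ _, _ => rfl
  | k + 1, .addExp γ β, h => by
    simp only [enc, encodeTerm, List.map_append, map_val_encodeTerm γ h,
      map_val_encodeTerm β (show k ≤ D + 1 by omega), List.map_cons, List.map_nil]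
    simp [Nat.mod_eq_of_lt (show k < D + 1 by omega)]

theorem mem_codeLang_of_isChain {D : ℕ} : ∀ {k : ℕ} {x : List (Fin (D + 1))}, k ≤ D + 1 →
    (∀ b ∈ x, b.val < k) → List.IsChain StepLe (x.map Fin.val ++ [k]) → x ∈ codeLang D k
  | 0, x, _, hx, _ => by
    cases x with
    | nil => rfl
    | cons a x => exact absurd (hx a (by simp)) (by omega)
  | k + 1, x, hk, hx, hc => by
    have hval : (Fin.ofNat (D + 1) k).val = k := Nat.mod_eq_of_lt (by omega)
    by_cases hm : Fin.ofNat (D + 1) k ∈ x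
    · -- The part up to the first letter `k` is a factor `P_{k-1} k`.
      obtain ⟨x₁, x₂, rfl, hx₁⟩ := List.eq_append_cons_of_mem hm
      simp only [List.map_append, List.map_cons, hval, List.append_assoc, List.cons_append] at hc
      rw [List.isChain_split] at hc
      have h₁ : x₁ ∈ codeLang D k := by
        refine mem_codeLang_of_isChain (by omega) (fun b hb => ?_) hc.1
        refine (Nat.lt_succ_iff.1 (hx b (by simp [hb]))).lt_of_ne fun h => hx₁ ?_
        rwa [show Fin.ofNat (D + 1) k = b from Fin.ext (hval.trans h.symm)]
      have h₂ : x₂ ∈ codeLang D (k + 1) :=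
        mem_codeLang_of_isChain hk (fun b hb => hx b (by simp [hb])) hc.2.tail
      rw [codeLang, ← Language.one_add_self_mul_kstar_eq_kstar]
      refine .inr (Language.mem_mul.2 ⟨x₁ ++ [Fin.ofNat (D + 1) k], ?_, x₂, h₂, by simp⟩)
      exact Language.mem_mul.2 ⟨x₁, h₁, _, rfl, rfl⟩
    · rcases List.eq_nil_or_concat x with rfl | ⟨y, b, rfl⟩
      · exact Language.nil_mem_kstar _
      · -- A last letter below `k` cannot precede `k + 1`.
        have hb := hx b (by simp)
        have h : k + 1 ≤ b.val + 1 := by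
          have := (List.isChain_append.1 hc).2.2 b.val (by simp) (k + 1) (by simp)
          exact this
        refine absurd ?_ hm
        rw [show Fin.ofNat (D + 1) k = b from Fin.ext (by omega)]
        simp
termination_by k x => (k, x.length)

end HardyWord

/-! ### The machine -/

namespace HardyMachine

open OrdTerm HardyWord

/-- A channel operation `(i, w, l)`: it writes the letter `l` on channel `i` if `w` is `true`, and
reads `l` from channel `i` otherwise. -/
abbrev Op : Type := Fin 3 × Bool × ℕ

/-- Reading `l` from channel `i`. -/
abbrev rd (i : Fin 3) (l : ℕ) : Op := (i, false, l)

/-- Writing `l` on channel `i`. -/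
abbrev wr (i : Fin 3) (l : ℕ) : Op := (i, true, l)

/-- The main control states.  The states in between are determined by the operations that remain
to be done before the next main state; see `Node`. -/
inductive Phase : Type
  /-- Verifies the code; `e` is the last letter that was read. -/
  | check (e : ℕ)
  /-- Rotates the counter, whose length is final. -/
  | count
  /-- Between two rewriting steps; every channel ends with its only marker. -/
  | main
  /-- Rotates the part of the code that is left unchanged. -/
  | scan
  /-- Moves the word `v` over `{0, …, a}` to the third channel. -/
  | load (a : ℕ)
  /-- Appends a copy of `v` to the first channel. -/
  | copy (a : ℕ)
  /-- A copy of `v` is complete. -/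
  | copied (a : ℕ)
  /-- Removes `v` from the third channel. -/
  | wipe (a : ℕ)
  /-- Rotates the rest of the code, which has to be `(e+1) … d`. -/
  | finish (e : ℕ)
  /-- A factor `v (a+1)` of the first channel has been removed. -/
  | collate (a : ℕ)
  /-- Checks that a copy of `v` comes next on the first channel, and removes it. -/
  | compare (a : ℕ)
  /-- Moves `v` back to the first channel. -/
  | restore (a : ℕ)

/-- The program.  An edge leads from one phase to another by a list of channel operations.

The edges `check_*` and `count_*` verify that the channels hold a code, a positive counter and
nothing.  From `main`, the machine replaces `(γ + 1, n)` by `(γ, n + 1)` (`pop`) or conversely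
(`push_*`), or `(λ, n)` by `(λ_n, n)` (`load_*`, `expand`, `copy_*`, `copied_*`, `wipe_*`,
`finish_*`) or conversely (`load_*`, `contract`, `collate_*`, `compare_*`, `restore_*`,
`finish_*`), and returns to `main`.  For a limit `λ` with code `u v a (a+1) (a+2) … d`, where
`λ_n` has the code `u (v (a+1))^n (a+2) … d`, the word `v` is kept on the third channel.  Every
rewriting step starts by rotating one `0` of the counter, so that it fails on the counter `0`, and
`n` copies of `v` take `n - 1` further rotations. -/
inductive Edge (d : ℕ) : Phase → List Op → Phase → Prop
  | check_letter {e l : ℕ} (he : e ≤ d) (hl : l ≤ d) (hel : l ≤ e + 1) :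
      Edge d (.check e) [rd 0 l, wr 0 l] (.check l)
  | check_mark : Edge d (.check d) [rd 0 (d + 1), wr 0 (d + 1), rd 1 0, wr 1 0] .count
  | count_zero : Edge d .count [rd 1 0, wr 1 0] .count
  | count_mark : Edge d .count [rd 1 (d + 1), wr 1 (d + 1), rd 2 (d + 1), wr 2 (d + 1)] .main
  | start : Edge d .main [rd 1 0, wr 1 0] .scan
  | scan_letter {l : ℕ} (hl : l ≤ d) : Edge d .scan [rd 0 l, wr 0 l] .scan
  | pop : Edge d .scan [rd 0 d, rd 0 (d + 1), wr 0 (d + 1), wr 1 0] .count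
  | push_nil :
      Edge d .main [rd 1 0, wr 1 0, rd 0 (d + 1), wr 0 d, wr 0 (d + 1), rd 1 0] .count
  | push_concat :
      Edge d .scan [rd 0 d, wr 0 d, rd 0 (d + 1), wr 0 d, wr 0 (d + 1), rd 1 0] .count
  | load_nil {a : ℕ} (ha : a < d) : Edge d .main [rd 1 0, wr 1 0, rd 2 (d + 1)] (.load a)
  | load_concat {a l : ℕ} (hl : l ≤ d) (hal : a + 1 ≤ l) :
      Edge d .scan [rd 0 l, wr 0 l, rd 2 (d + 1)] (.load a)
  | load_letter {a l : ℕ} (ha : a < d) (hl : l ≤ a) :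
      Edge d (.load a) [rd 0 l, wr 2 l] (.load a)
  | expand {a : ℕ} (ha : a < d) :
      Edge d (.load a) [rd 0 a, rd 0 (a + 1), wr 2 (d + 1)] (.copy a)
  | copy_letter {a l : ℕ} (ha : a < d) (hl : l ≤ a) :
      Edge d (.copy a) [rd 2 l, wr 0 l, wr 2 l] (.copy a)
  | copy_mark {a : ℕ} (ha : a < d) :
      Edge d (.copy a) [rd 2 (d + 1), wr 0 (a + 1), wr 2 (d + 1)] (.copied a)
  | copied_zero {a : ℕ} (ha : a < d) : Edge d (.copied a) [rd 1 0, wr 1 0] (.copy a)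
  | copied_mark {a : ℕ} (ha : a < d) :
      Edge d (.copied a) [rd 1 (d + 1), wr 1 (d + 1)] (.wipe a)
  | wipe_letter {a l : ℕ} (ha : a < d) (hl : l ≤ a) : Edge d (.wipe a) [rd 2 l] (.wipe a)
  | wipe_mark {a : ℕ} (ha : a < d) :
      Edge d (.wipe a) [rd 2 (d + 1), wr 2 (d + 1)] (.finish (a + 1))
  | finish_letter {e : ℕ} (he : e < d) :
      Edge d (.finish e) [rd 0 (e + 1), wr 0 (e + 1)] (.finish (e + 1))
  | finish_mark : Edge d (.finish d) [rd 0 (d + 1), wr 0 (d + 1)] .main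
  | contract {a : ℕ} (ha : a < d) :
      Edge d (.load a) [rd 0 (a + 1), wr 2 (d + 1)] (.collate a)
  | collate_zero {a : ℕ} (ha : a < d) : Edge d (.collate a) [rd 1 0, wr 1 0] (.compare a)
  | compare_letter {a l : ℕ} (ha : a < d) (hl : l ≤ a) :
      Edge d (.compare a) [rd 2 l, rd 0 l, wr 2 l] (.compare a)
  | compare_mark {a : ℕ} (ha : a < d) :
      Edge d (.compare a) [rd 2 (d + 1), rd 0 (a + 1), wr 2 (d + 1)] (.collate a)
  | collate_mark {a : ℕ} (ha : a < d) :
      Edge d (.collate a) [rd 1 (d + 1), wr 1 (d + 1)] (.restore a)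
  | restore_nil {a : ℕ} (ha : a < d) :
      Edge d (.collate a) [rd 1 (d + 1), wr 1 (d + 1), rd 2 (d + 1), wr 2 (d + 1),
        wr 0 a, wr 0 (a + 1)] (.finish (a + 1))
  | restore_letter {a l : ℕ} (ha : a < d) (hl : l ≤ a) :
      Edge d (.restore a) [rd 2 l, wr 0 l] (.restore a)
  | restore_concat {a : ℕ} (ha : a < d) :
      Edge d (.restore a) [rd 2 a, wr 0 a, rd 2 (d + 1), wr 2 (d + 1), wr 0 a, wr 0 (a + 1)]
        (.finish (a + 1))

/-- Contents of the three channels. -/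
abbrev Chans : Type := Fin 3 → List ℕ

/-- The write-superseding semantics of a single operation. -/
inductive OpStep : Op → Chans → Chans → Prop
  | rd {i : Fin 3} {l : ℕ} {X : Chans} {y : List ℕ} (h : X i = l :: y) :
      OpStep (rd i l) X (Function.update X i y)
  | wr {i : Fin 3} {l : ℕ} {X : Chans} {z z' : List ℕ} (h : X i = z ++ z')
      (hz : ∀ b ∈ z', b ≤ l) : OpStep (wr i l) X (Function.update X i (z ++ [l]))

/-! ### Soundness -/

/-- `After ops Φ X`: every way to carry out `ops` from `X` ends in `Φ`. -/
def After : List Op → (Chans → Prop) → Chans → Prop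
  | [], Φ, X => Φ X
  | op :: ops, Φ, X => ∀ X', OpStep op X X' → After ops Φ X'

section After

variable {ops : List Op} {Φ : Chans → Prop} {o c t : List ℕ} {l : ℕ}

theorem update_zero (y : List ℕ) : Function.update ![o, c, t] 0 y = ![y, c, t] := by
  ext i : 1; fin_cases i <;> rfl

theorem update_one (y : List ℕ) : Function.update ![o, c, t] 1 y = ![o, y, t] := by
  ext i : 1; fin_cases i <;> rfl

theorem update_two (y : List ℕ) : Function.update ![o, c, t] 2 y = ![o, c, y] := by
  ext i : 1; fin_cases i <;> rfl

theorem after_nil (h : Φ ![o, c, t]) : After [] Φ ![o, c, t] := h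

theorem after_rd_zero (h : ∀ y, o = l :: y → After ops Φ ![y, c, t]) :
    After (rd 0 l :: ops) Φ ![o, c, t] := by
  rintro _ ⟨hX⟩; rw [update_zero]; exact h _ hX

theorem after_rd_one (h : ∀ y, c = l :: y → After ops Φ ![o, y, t]) :
    After (rd 1 l :: ops) Φ ![o, c, t] := by
  rintro _ ⟨hX⟩; rw [update_one]; exact h _ hX

theorem after_rd_two (h : ∀ y, t = l :: y → After ops Φ ![o, c, y]) :
    After (rd 2 l :: ops) Φ ![o, c, t] := by
  rintro _ ⟨hX⟩; rw [update_two]; exact h _ hX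

theorem after_wr_zero
    (h : ∀ z z', o = z ++ z' → (∀ b ∈ z', b ≤ l) → After ops Φ ![z ++ [l], c, t]) :
    After (wr 0 l :: ops) Φ ![o, c, t] := by
  rintro _ (_ | ⟨hX, hz⟩); rw [update_zero]; exact h _ _ hX hz

theorem after_wr_one
    (h : ∀ z z', c = z ++ z' → (∀ b ∈ z', b ≤ l) → After ops Φ ![o, z ++ [l], t]) :
    After (wr 1 l :: ops) Φ ![o, c, t] := by
  rintro _ (_ | ⟨hX, hz⟩); rw [update_one]; exact h _ _ hX hz

theorem after_wr_two
    (h : ∀ z z', t = z ++ z' → (∀ b ∈ z', b ≤ l) → After ops Φ ![o, c, z ++ [l]]) :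
    After (wr 2 l :: ops) Φ ![o, c, t] := by
  rintro _ (_ | ⟨hX, hz⟩); rw [update_two]; exact h _ _ hX hz

end After

/-- `Below a x`: the word `x` is over the alphabet `{0, …, a}`. -/
def Below (a : ℕ) (x : List ℕ) : Prop := ∀ b ∈ x, b ≤ a

namespace Below

variable {a b d l : ℕ} {x y r w z z' : List ℕ}

theorem nil : Below a [] := by simp [Below]

theorem mono (h : Below a x) (hab : a ≤ b) : Below b x := fun c hc => (h c hc).trans hab

theorem append : Below a (x ++ y) ↔ Below a x ∧ Below a y := List.forall_mem_append

theorem cons : Below a (l :: x) ↔ l ≤ a ∧ Below a x := List.forall_mem_cons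

theorem concat (h : Below a x) (hl : l ≤ a) : Below a (x ++ [l]) :=
  append.2 ⟨h, cons.2 ⟨hl, nil⟩⟩

theorem read_letter (hl : l ≤ d) (h : r ++ (d + 1) :: w = l :: y) :
    ∃ r', r = l :: r' ∧ y = r' ++ (d + 1) :: w := by
  cases r with
  | nil => simp only [List.nil_append, List.cons.injEq] at h; omega
  | cons c r =>
    simp only [List.cons_append, List.cons.injEq] at h
    exact ⟨r, by rw [h.1], h.2.symm⟩

theorem read_mark (hr : Below d r) (h : r ++ (d + 1) :: w = (d + 1) :: y) : r = [] ∧ y = w := by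
  cases r with
  | nil => simpa [eq_comm] using h
  | cons c r =>
    simp only [List.cons_append, List.cons.injEq] at h
    have := hr c (by simp)
    omega

theorem write_letter (hl : l ≤ d) (h : r ++ (d + 1) :: w = z ++ z') (hz : ∀ b ∈ z', b ≤ l) :
    ∃ w', w = w' ++ z' ∧ z = r ++ (d + 1) :: w' := by
  rcases List.append_eq_append_iff.1 h with ⟨u, rfl, hu⟩ | ⟨u, rfl, rfl⟩
  · cases u with
    | nil =>
      have := hz (d + 1) (by rw [← List.nil_append z', ← hu]; simp)
      omega
    | cons b u =>
      simp only [List.cons_append, List.cons.injEq] at hu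
      obtain ⟨rfl, rfl⟩ := hu
      exact ⟨u, rfl, rfl⟩
  · have := hz (d + 1) (by simp)
    omega

end Below

/-- The counter word `0^n`. -/
abbrev zeros (n : ℕ) : List ℕ := List.replicate n 0

theorem below_zeros (d n : ℕ) : Below d (zeros n) := by
  intro b hb
  simp [List.eq_of_mem_replicate hb]

theorem zeros_eq_append {n : ℕ} {z z' : List ℕ} (h : zeros n = z ++ z') :
    ∃ m ≤ n, z = zeros m := by
  have := List.append_eq_replicate_iff.1 h.symm
  exact ⟨z.length, by omega, this.2.1⟩

theorem read_zero {d i : ℕ} {w y : List ℕ} (h : zeros i ++ (d + 1) :: w = 0 :: y) :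
    ∃ i', i = i' + 1 ∧ y = zeros i' ++ (d + 1) :: w := by
  obtain ⟨r, hr, rfl⟩ := Below.read_letter (Nat.zero_le d) h
  cases i with
  | zero => simp at hr
  | succ i =>
    simp only [List.replicate_succ, List.cons.injEq, true_and] at hr
    exact ⟨i, rfl, by rw [← hr]⟩

theorem read_zeros_mark {d i : ℕ} {w y : List ℕ}
    (h : zeros i ++ (d + 1) :: w = (d + 1) :: y) : i = 0 ∧ y = w := by
  obtain ⟨h, rfl⟩ := Below.read_mark (below_zeros d i) h
  exact ⟨by simpa using h, rfl⟩

theorem write_zero {d j : ℕ} {r z z' : List ℕ} (h : r ++ (d + 1) :: zeros j = z ++ z')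
    (hz : ∀ b ∈ z', b ≤ 0) :
    ∃ j' ≤ j, z ++ [0] = r ++ (d + 1) :: zeros (j' + 1) := by
  obtain ⟨w, hw, rfl⟩ := Below.write_letter (Nat.zero_le d) h hz
  obtain ⟨j', hj, rfl⟩ := zeros_eq_append hw
  exact ⟨j', hj, by simp [List.replicate_succ']⟩

/-- The properties of the initial channel contents that safety asserts. -/
def Good (d : ℕ) (x₀ y₀ z₀ : List ℕ) : Prop :=
  List.IsChain StepLe (d :: (x₀ ++ [d + 1])) ∧ (∃ n, y₀ = zeros (n + 1)) ∧ z₀ = []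

/-- The value of `(x, n)` is at most that of the initial contents, and these are good.  The value
is taken at some positive `m ≥ n`, as the Hardy functions are monotone only there; this makes `Ok`
monotone for all `n`. -/
def Ok (d : ℕ) (x₀ y₀ z₀ x : List ℕ) (n : ℕ) : Prop :=
  Good d x₀ y₀ z₀ ∧
    ∃ m, n ≤ m ∧ 1 ≤ m ∧ hardy (decode d x) m ≤ hardy (decode d x₀) y₀.length

namespace Ok

variable {d : ℕ} {x₀ y₀ z₀ x x' : List ℕ} {n n' : ℕ}

theorem emb (h : Ok d x₀ y₀ z₀ x n) (hx : Emb (decode d x') (decode d x)) (hn : n' ≤ n) :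
    Ok d x₀ y₀ z₀ x' n' := by
  obtain ⟨hg, m, hm, h1, hle⟩ := h
  exact ⟨hg, m, hn.trans hm, h1, (hardy_mono hx le_rfl h1).trans hle⟩

theorem loss (h : Ok d x₀ y₀ z₀ x n) (hx : Loss x' x) (hn : n' ≤ n) : Ok d x₀ y₀ z₀ x' n' :=
  h.emb hx.decode hn

theorem le (h : Ok d x₀ y₀ z₀ x n) (hn : n' ≤ n) : Ok d x₀ y₀ z₀ x n' := h.emb (.refl _) hn

theorem hardy_le (h : Ok d x₀ y₀ z₀ x n) :
    hardy (decode d x) n ≤ hardy (decode d x₀) y₀.length := by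
  obtain ⟨-, m, hm, h1, hle⟩ := h
  exact (hardy_mono (.refl _) hm h1).trans hle

theorem of_hardy_le (h : Ok d x₀ y₀ z₀ x n) (hn : 1 ≤ n')
    (hle : hardy (decode d x') n' ≤ hardy (decode d x) n) : Ok d x₀ y₀ z₀ x' n' :=
  ⟨h.1, n', le_rfl, hn, hle.trans h.hardy_le⟩

end Ok

/-- The invariant of each phase, for a run from `x₀ $`, `y₀ $`, `z₀ $`.  A channel that is being
read and rewritten in a cycle has contents `r $ w`, where `r` is still to be read and `w` has been
written.

The bound is stated for the word that results from completing or undoing the step in progress.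
Where the machine has yet to check a part of the input, namely that `r` is `(e+1) … d`, or that
`v` ends with `a`, the bound is conditional on the outcome. -/
def Inv (d : ℕ) (x₀ y₀ z₀ : List ℕ) : Phase → Chans → Prop
  | .check e, X => ∃ r w, X = ![r ++ (d + 1) :: w, y₀ ++ [d + 1], z₀ ++ [d + 1]] ∧
      Below d r ∧ Below d w ∧ Below d y₀ ∧ Below d z₀ ∧
      (List.IsChain StepLe (e :: (r ++ [d + 1])) → List.IsChain StepLe (d :: (x₀ ++ [d + 1]))) ∧
      (1 ≤ y₀.length →
        hardy (decode d (w ++ r)) y₀.length ≤ hardy (decode d x₀) y₀.length)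
  | .count, X => ∃ x r j z, X = ![x ++ [d + 1], r ++ (d + 1) :: zeros (j + 1), z ++ [d + 1]] ∧
      Below d x ∧ Below d r ∧ Below d z ∧
      ∀ i, r = zeros i → z = [] → Ok d x₀ y₀ z₀ x (i + j + 1)
  | .main, X => ∃ x n, X = ![x ++ [d + 1], zeros n ++ [d + 1], [d + 1]] ∧ Below d x ∧
      Ok d x₀ y₀ z₀ x n
  | .scan, X => ∃ r w i, X = ![r ++ (d + 1) :: w, zeros i ++ [d + 1, 0], [d + 1]] ∧
      Below d r ∧ Below d w ∧ Ok d x₀ y₀ z₀ (w ++ r) (i + 1)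
  | .load a, X => a < d ∧ ∃ r w v i, X = ![r ++ (d + 1) :: w, zeros i ++ [d + 1, 0], v] ∧
      Below d r ∧ Below d w ∧ Below a v ∧ Clean (levels (fun _ => .zero) w) a ∧
      Ok d x₀ y₀ z₀ (w ++ v ++ r) (i + 1)
  | .copy a, X => a < d ∧ ∃ r w t₁ t₂ i j,
      X = ![r ++ (d + 1) :: w, zeros i ++ (d + 1) :: zeros (j + 1), t₂ ++ (d + 1) :: t₁] ∧
      Below d r ∧ Below d w ∧ Below a t₁ ∧ Below a t₂ ∧
      (r = tail d (a + 1) → Ok d x₀ y₀ z₀ (w ++ t₂ ++ [a + 1] ++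
        (List.replicate i (t₁ ++ t₂ ++ [a + 1])).flatten ++ r) (i + j + 1))
  | .copied a, X => a < d ∧ ∃ r w v i j,
      X = ![r ++ (d + 1) :: w, zeros i ++ (d + 1) :: zeros (j + 1), v ++ [d + 1]] ∧
      Below d r ∧ Below d w ∧ Below a v ∧
      (r = tail d (a + 1) → Ok d x₀ y₀ z₀ (w ++
        (List.replicate i (v ++ [a + 1])).flatten ++ r) (i + j + 1))
  | .wipe a, X => a < d ∧ ∃ r w v j,
      X = ![r ++ (d + 1) :: w, zeros j ++ [d + 1], v ++ [d + 1]] ∧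
      Below d r ∧ Below d w ∧ Below a v ∧
      (r = tail d (a + 1) → Ok d x₀ y₀ z₀ (w ++ r) j)
  | .finish e, X => ∃ r w j, X = ![r ++ (d + 1) :: w, zeros j ++ [d + 1], [d + 1]] ∧
      Below d r ∧ Below d w ∧ (r = tail d e → Ok d x₀ y₀ z₀ (w ++ r) j)
  | .collate a, X => a < d ∧ ∃ r w v i j k,
      X = ![r ++ (d + 1) :: w, zeros i ++ (d + 1) :: zeros (j + 1), v ++ [d + 1]] ∧
      Below d r ∧ Below d w ∧ Below a v ∧ Clean (levels (fun _ => .zero) w) a ∧ j ≤ k ∧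
      Ok d x₀ y₀ z₀ (w ++ (List.replicate (k + 1) (v ++ [a + 1])).flatten ++ r) (i + k + 1)
  | .compare a, X => a < d ∧ ∃ r w t₁ t₂ i j k,
      X = ![r ++ (d + 1) :: w, zeros i ++ (d + 1) :: zeros (j + 1), t₂ ++ (d + 1) :: t₁] ∧
      Below d r ∧ Below d w ∧ Below a t₁ ∧ Below a t₂ ∧
      Clean (levels (fun _ => .zero) w) a ∧ j ≤ k + 1 ∧
      Ok d x₀ y₀ z₀ (w ++ (List.replicate (k + 1) (t₁ ++ t₂ ++ [a + 1])).flatten ++ t₁ ++ r)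
        (i + k + 2)
  | .restore a, X => a < d ∧ ∃ r w v j,
      X = ![r ++ (d + 1) :: w, zeros j ++ [d + 1], v ++ [d + 1]] ∧
      Below d r ∧ Below d w ∧ Below a v ∧
      ∀ v', v = v' ++ [a] → r = tail d (a + 1) → Ok d x₀ y₀ z₀ (w ++ v ++ [a, a + 1] ++ r) j

variable {d : ℕ} {x₀ y₀ z₀ : List ℕ}

open Below in
/-- All edges preserve the invariant.  Messages lost to superseding are accounted for by `Loss`, and
the two steps at limits by `hardy_expand` and `hardy_contract`. -/
theorem Edge.sound {p q : Phase} {ops : List Op} (h : Edge d p ops q) {X : Chans}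
    (hX : Inv d x₀ y₀ z₀ p X) : After ops (Inv d x₀ y₀ z₀ q) X := by
  cases h with
  | check_letter he hl hel =>
    obtain ⟨r, w, rfl, hr, hw, hy₀, hz₀, hc, hle⟩ := hX
    refine after_rd_zero fun y hy => ?_
    obtain ⟨r, rfl, rfl⟩ := read_letter hl hy
    refine after_wr_zero fun z z' h hz => after_nil ?_
    obtain ⟨w, rfl, rfl⟩ := write_letter hl h hz
    refine ⟨r, w ++ [_], by simp, (cons.1 hr).2, (append.1 hw).1.concat hl, hy₀, hz₀, ?_, ?_⟩
    · exact fun h => hc (.cons_cons hel h)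
    · refine fun h => (hardy_mono (Loss.decode ?_) le_rfl h).trans (hle h)
      simpa using Loss.supersede_append hz w r
  | check_mark =>
    obtain ⟨r, w, rfl, hr, hw, hy₀, hz₀, hc, hle⟩ := hX
    refine after_rd_zero fun y hy => ?_
    obtain ⟨rfl, rfl⟩ := read_mark hr hy
    refine after_wr_zero fun z z' h hz => ?_
    subst h
    refine after_rd_one fun y hy => ?_
    obtain ⟨r, rfl, rfl⟩ := read_letter (Nat.zero_le d) hy
    refine after_wr_one fun u u' h hu => after_nil ?_
    obtain ⟨j, hj, h⟩ := write_zero (j := 0) h hu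
    obtain rfl : j = 0 := by omega
    rw [h]
    refine ⟨z, r, 0, z₀, rfl, (append.1 hw).1, (cons.1 hy₀).2, hz₀, ?_⟩
    rintro i rfl rfl
    refine Ok.emb (x := z ++ z') ⟨⟨hc ?_, ⟨i, rfl⟩, rfl⟩, i + 1, le_rfl, by omega, ?_⟩
      (decode_append_emb (append.1 hw).2 z) le_rfl
    · simp [StepLe]
    · simpa using hle (by simp)
  | count_zero =>
    obtain ⟨x, r, j, z, rfl, hx, hr, hz, hok⟩ := hX
    refine after_rd_one fun y hy => ?_
    obtain ⟨r, rfl, rfl⟩ := read_letter (Nat.zero_le d) hy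
    refine after_wr_one fun u u' h hu => after_nil ?_
    obtain ⟨j', hj, h⟩ := write_zero h hu
    rw [h]
    refine ⟨x, r, j', z, rfl, hx, (cons.1 hr).2, hz, fun i hi hz => ?_⟩
    exact (hok (i + 1) (by rw [hi]; rfl) hz).le (by omega)
  | count_mark =>
    obtain ⟨x, r, j, z, rfl, hx, hr, hz, hok⟩ := hX
    refine after_rd_one fun y hy => ?_
    obtain ⟨rfl, rfl⟩ := read_mark hr hy
    refine after_wr_one fun u u' h hu => ?_
    obtain ⟨j', hj, rfl⟩ := zeros_eq_append h
    refine after_rd_two fun y hy => ?_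
    obtain ⟨rfl, rfl⟩ := read_mark hz hy
    refine after_wr_two fun s s' h hs => after_nil ?_
    obtain ⟨rfl, rfl⟩ := List.append_eq_nil_iff.1 h.symm
    exact ⟨x, j', rfl, hx, (hok 0 rfl rfl).le (by omega)⟩
  | start =>
    obtain ⟨x, n, rfl, hx, hok⟩ := hX
    refine after_rd_one fun y hy => ?_
    obtain ⟨i, rfl, rfl⟩ := read_zero hy
    refine after_wr_one fun u u' h hu => after_nil ?_
    obtain ⟨j, hj, h⟩ := write_zero (j := 0) h hu
    obtain rfl : j = 0 := by omega
    rw [h]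
    exact ⟨x, [], i, rfl, hx, nil, hok⟩
  | scan_letter hl =>
    obtain ⟨r, w, i, rfl, hr, hw, hok⟩ := hX
    refine after_rd_zero fun y hy => ?_
    obtain ⟨r, rfl, rfl⟩ := read_letter hl hy
    refine after_wr_zero fun z z' h hz => after_nil ?_
    obtain ⟨w, rfl, rfl⟩ := write_letter hl h hz
    refine ⟨r, w ++ [_], i, by simp, (cons.1 hr).2, (append.1 hw).1.concat hl, hok.loss ?_ le_rfl⟩
    simpa using Loss.supersede_append hz w r
  | pop =>
    obtain ⟨r, w, i, rfl, hr, hw, hok⟩ := hX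
    refine after_rd_zero fun y hy => ?_
    obtain ⟨r, rfl, rfl⟩ := read_letter le_rfl hy
    refine after_rd_zero fun y hy => ?_
    obtain ⟨rfl, rfl⟩ := read_mark (cons.1 hr).2 hy
    refine after_wr_zero fun z z' h hz => ?_
    subst h
    refine after_wr_one fun u u' h hu => after_nil ?_
    obtain ⟨j, hj, h⟩ := write_zero (j := 1) h hu
    rw [h]
    refine ⟨z, zeros i, j, [], rfl, (append.1 hw).1, below_zeros d i, nil, fun i' hi _ => ?_⟩
    obtain rfl : i = i' := by simpa using congrArg List.length hi
    have := hok.of_hardy_le (by omega) (hardy_pop d (z ++ z') (by omega))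
    exact this.emb (decode_append_emb (append.1 hw).2 z) (by omega)
  | push_nil =>
    obtain ⟨x, n, rfl, hx, hok⟩ := hX
    refine after_rd_one fun y hy => ?_
    obtain ⟨i, rfl, rfl⟩ := read_zero hy
    refine after_wr_one fun u u' h hu => ?_
    obtain ⟨j, hj, h⟩ := write_zero (j := 0) h hu
    obtain rfl : j = 0 := by omega
    rw [h]
    refine after_rd_zero fun y hy => ?_
    obtain ⟨rfl, rfl⟩ := read_mark hx hy
    refine after_wr_zero fun s s' h hs => ?_
    obtain ⟨rfl, rfl⟩ := List.append_eq_nil_iff.1 h.symm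
    refine after_wr_zero fun z z' h' _ => ?_
    refine after_rd_one fun y hy => after_nil ?_
    obtain ⟨i, rfl, rfl⟩ := read_zero hy
    have hb : Below d (z ++ z') := h' ▸ concat nil le_rfl
    refine ⟨z, zeros i, 0, [], rfl, (append.1 hb).1, below_zeros d i, nil, fun i' hi _ => ?_⟩
    obtain rfl : i = i' := by simpa using congrArg List.length hi
    have := hok.of_hardy_le (by omega) (hardy_push d (.inl rfl) (i + 1)).le
    rw [h'] at this
    exact this.emb (decode_append_emb (append.1 hb).2 z) (by omega)
  | push_concat =>
    obtain ⟨r, w, i, rfl, hr, hw, hok⟩ := hX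
    refine after_rd_zero fun y hy => ?_
    obtain ⟨r, rfl, rfl⟩ := read_letter le_rfl hy
    refine after_wr_zero fun w z' h hz => ?_
    obtain ⟨w, rfl, rfl⟩ := write_letter le_rfl h hz
    refine after_rd_zero fun y hy => ?_
    rw [List.append_assoc] at hy
    obtain ⟨rfl, rfl⟩ := read_mark (cons.1 hr).2 hy
    refine after_wr_zero fun s s' h hs => ?_
    refine after_wr_zero fun u u' h' _ => ?_
    refine after_rd_one fun y hy => after_nil ?_
    obtain ⟨i, rfl, rfl⟩ := read_zero hy
    have hsb : Below d (s ++ s') := h ▸ (append.1 hw).1.concat le_rfl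
    have hub : Below d (u ++ u') := h' ▸ (append.1 hsb).1.concat le_rfl
    refine ⟨u, zeros i, 0, [], rfl, (append.1 hub).1, below_zeros d i, nil, fun i' hi _ => ?_⟩
    obtain rfl : i = i' := by simpa using congrArg List.length hi
    have h₁ := hok.loss (by simpa using Loss.supersede_append hz w []) le_rfl
    have h₂ := h₁.of_hardy_le (by omega) (hardy_push d (.inr ⟨w, rfl⟩) (i + 1)).le
    rw [show w ++ [d] = s ++ s' from h] at h₂
    have h₃ := h₂.loss (by simpa using Loss.supersede_append hs s []) le_rfl
    rw [h'] at h₃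
    exact h₃.emb (decode_append_emb (append.1 hub).2 u) (by omega)
  | load_nil ha =>
    obtain ⟨x, n, rfl, hx, hok⟩ := hX
    refine after_rd_one fun y hy => ?_
    obtain ⟨i, rfl, rfl⟩ := read_zero hy
    refine after_wr_one fun u u' h hu => ?_
    obtain ⟨j, hj, h⟩ := write_zero (j := 0) h hu
    obtain rfl : j = 0 := by omega
    rw [h]
    refine after_rd_two fun y hy => after_nil ?_
    obtain ⟨-, rfl⟩ := read_mark (r := []) nil hy
    exact ⟨ha, x, [], [], i, rfl, hx, nil, nil, fun _ _ => rfl, hok⟩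
  | load_concat hl hal =>
    obtain ⟨r, w, i, rfl, hr, hw, hok⟩ := hX
    refine after_rd_zero fun y hy => ?_
    obtain ⟨r, rfl, rfl⟩ := read_letter hl hy
    refine after_wr_zero fun z z' h hz => ?_
    obtain ⟨w, rfl, rfl⟩ := write_letter hl h hz
    refine after_rd_two fun y hy => after_nil ?_
    obtain ⟨-, rfl⟩ := read_mark (r := []) nil hy
    refine ⟨by omega, r, w ++ [_], [], i, by simp, (cons.1 hr).2, (append.1 hw).1.concat hl, nil,
      clean_levels_concat _ _ hal, hok.loss ?_ le_rfl⟩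
    simpa using Loss.supersede_append hz w r
  | load_letter ha hl =>
    obtain ⟨-, r, w, v, i, rfl, hr, hw, hv, hcl, hok⟩ := hX
    refine after_rd_zero fun y hy => ?_
    obtain ⟨r, rfl, rfl⟩ := read_letter (by omega) hy
    refine after_wr_two fun z z' h hz => after_nil ?_
    subst h
    refine ⟨ha, r, w, _, i, rfl, (cons.1 hr).2, hw, (append.1 hv).1.concat hl, hcl,
      hok.loss ?_ le_rfl⟩
    simpa using Loss.supersede_append hz (w ++ z) r
  | @expand a ha =>
    obtain ⟨-, r, w, v, i, rfl, hr, hw, hv, hcl, hok⟩ := hX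
    refine after_rd_zero fun y hy => ?_
    obtain ⟨r, rfl, rfl⟩ := read_letter (by omega) hy
    refine after_rd_zero fun y hy => ?_
    obtain ⟨r, rfl, rfl⟩ := read_letter (by omega) hy
    refine after_wr_two fun z z' h hz => after_nil ?_
    subst h
    refine ⟨ha, r, w, [], z, i, 0, rfl, (cons.1 (cons.1 hr).2).2, hw, nil, (append.1 hv).1, ?_⟩
    rintro rfl
    have h₁ : Ok d x₀ y₀ z₀ (w ++ (List.replicate (i + 1) (z ++ z' ++ [a + 1])).flatten
        ++ tail d (a + 1)) (i + 1) :=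
      hok.of_hardy_le (by omega) (by simpa using hardy_expand ha w hv (Nat.succ_pos i))
    have h₂ : Loss (z ++ [a + 1]) (z ++ z' ++ [a + 1]) := by
      simpa using Loss.supersede_append ((append.1 hv).2.mono (Nat.le_succ a)) z []
    refine h₁.loss ?_ le_rfl
    simpa [List.replicate_succ] using
      ((h₂.flatten_replicate (i + 1)).append_left w).append_right (tail d (a + 1))
  | @copy_letter a l ha hl =>
    obtain ⟨-, r, w, t₁, t₂, i, j, rfl, hr, hw, ht₁, ht₂, hok⟩ := hX
    refine after_rd_two fun y hy => ?_
    obtain ⟨t₂, rfl, rfl⟩ := read_letter (by omega) hy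
    refine after_wr_zero fun z z' h hz => ?_
    obtain ⟨w, rfl, rfl⟩ := write_letter (by omega) h hz
    refine after_wr_two fun u u' h hu => after_nil ?_
    obtain ⟨t₁, rfl, rfl⟩ := write_letter (by omega) h hu
    refine ⟨ha, r, w ++ [l], t₁ ++ [l], t₂, i, j, by simp, hr,
      (append.1 hw).1.concat (by omega), (append.1 ht₁).1.concat hl, (cons.1 ht₂).2,
      fun h => (hok h).loss ?_ le_rfl⟩
    have h₁ := Loss.supersede_append hz w (t₂ ++ [a + 1])
    have h₂ := Loss.supersede_append hu t₁ (t₂ ++ [a + 1])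
    simpa using (h₁.append (h₂.flatten_replicate i)).append_right r
  | @copy_mark a ha =>
    obtain ⟨-, r, w, t₁, t₂, i, j, rfl, hr, hw, ht₁, ht₂, hok⟩ := hX
    refine after_rd_two fun y hy => ?_
    obtain ⟨rfl, rfl⟩ := read_mark (ht₂.mono ha.le) hy
    refine after_wr_zero fun z z' h hz => ?_
    obtain ⟨w, rfl, rfl⟩ := write_letter (by omega) h hz
    refine after_wr_two fun u u' h _ => after_nil ?_
    subst h
    refine ⟨ha, r, w ++ [a + 1], u, i, j, by simp, hr,
      (append.1 hw).1.concat (by omega), (append.1 ht₁).1, fun h => (hok h).loss ?_ le_rfl⟩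
    have h₁ := Loss.supersede_append hz w []
    have h₂ := Loss.supersede_append ((append.1 ht₁).2.mono (Nat.le_succ a)) u []
    simpa using (h₁.append (h₂.flatten_replicate i)).append_right r
  | copied_zero ha =>
    obtain ⟨-, r, w, v, i, j, rfl, hr, hw, hv, hok⟩ := hX
    refine after_rd_one fun y hy => ?_
    obtain ⟨i, rfl, rfl⟩ := read_zero hy
    refine after_wr_one fun u u' h hu => after_nil ?_
    obtain ⟨j', hj, h⟩ := write_zero h hu
    rw [h]
    refine ⟨ha, r, w, [], v, i, j', rfl, hr, hw, nil, hv, fun h => ?_⟩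
    simpa [List.replicate_succ] using (hok h).le (by omega)
  | copied_mark ha =>
    obtain ⟨-, r, w, v, i, j, rfl, hr, hw, hv, hok⟩ := hX
    refine after_rd_one fun y hy => ?_
    obtain ⟨rfl, rfl⟩ := read_zeros_mark hy
    refine after_wr_one fun u u' h hu => after_nil ?_
    obtain ⟨m, hm, rfl⟩ := zeros_eq_append h
    refine ⟨ha, r, w, v, m, rfl, hr, hw, hv, fun h => ?_⟩
    simpa using (hok h).le (n' := m) (by omega)
  | wipe_letter ha hl =>
    obtain ⟨-, r, w, v, j, rfl, hr, hw, hv, hok⟩ := hX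
    refine after_rd_two fun y hy => after_nil ?_
    obtain ⟨v, rfl, rfl⟩ := read_letter (by omega) hy
    exact ⟨ha, r, w, v, j, rfl, hr, hw, (cons.1 hv).2, hok⟩
  | wipe_mark ha =>
    obtain ⟨-, r, w, v, j, rfl, hr, hw, hv, hok⟩ := hX
    refine after_rd_two fun y hy => ?_
    obtain ⟨rfl, rfl⟩ := read_mark (hv.mono ha.le) hy
    refine after_wr_two fun u u' h _ => after_nil ?_
    obtain ⟨rfl, rfl⟩ := List.append_eq_nil_iff.1 h.symm
    exact ⟨r, w, j, rfl, hr, hw, hok⟩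
  | @finish_letter e he =>
    obtain ⟨r, w, j, rfl, hr, hw, hok⟩ := hX
    refine after_rd_zero fun y hy => ?_
    obtain ⟨r, rfl, rfl⟩ := read_letter (by omega) hy
    refine after_wr_zero fun z z' h hz => after_nil ?_
    obtain ⟨w, rfl, rfl⟩ := write_letter (by omega) h hz
    refine ⟨r, w ++ [e + 1], j, by simp, (cons.1 hr).2, (append.1 hw).1.concat (by omega),
      fun h => (hok (by rw [h, tail_of_lt he])).loss ?_ le_rfl⟩
    simpa using Loss.supersede_append hz w r
  | finish_mark =>
    obtain ⟨r, w, j, rfl, hr, hw, hok⟩ := hX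
    refine after_rd_zero fun y hy => ?_
    obtain ⟨rfl, rfl⟩ := read_mark hr hy
    refine after_wr_zero fun z z' h _ => after_nil ?_
    subst h
    have := hok (tail_self d).symm
    rw [List.append_nil] at this
    exact ⟨z, j, rfl, (append.1 hw).1, this.emb (decode_append_emb (append.1 hw).2 z) le_rfl⟩
  | @contract a ha =>
    obtain ⟨-, r, w, v, i, rfl, hr, hw, hv, hcl, hok⟩ := hX
    refine after_rd_zero fun y hy => ?_
    obtain ⟨r, rfl, rfl⟩ := read_letter (by omega) hy
    refine after_wr_two fun z z' h _ => after_nil ?_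
    subst h
    refine ⟨ha, r, w, z, i, 0, 0, rfl, (cons.1 hr).2, hw, (append.1 hv).1, hcl, le_rfl,
      hok.loss ?_ le_rfl⟩
    simpa using Loss.supersede_append ((append.1 hv).2.mono (Nat.le_succ a)) (w ++ z) r
  | collate_zero ha =>
    obtain ⟨-, r, w, v, i, j, k, rfl, hr, hw, hv, hcl, hjk, hok⟩ := hX
    refine after_rd_one fun y hy => ?_
    obtain ⟨i, rfl, rfl⟩ := read_zero hy
    refine after_wr_one fun u u' h hu => after_nil ?_
    obtain ⟨j', hj, h⟩ := write_zero h hu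
    rw [h]
    refine ⟨ha, r, w, [], v, i, j', k, rfl, hr, hw, nil, hv, hcl, by omega, ?_⟩
    simpa using hok.le (n' := i + k + 2) (by omega)
  | @compare_letter a l ha hl =>
    obtain ⟨-, r, w, t₁, t₂, i, j, k, rfl, hr, hw, ht₁, ht₂, hcl, hjk, hok⟩ := hX
    refine after_rd_two fun y hy => ?_
    obtain ⟨t₂, rfl, rfl⟩ := read_letter (by omega) hy
    refine after_rd_zero fun y hy => ?_
    obtain ⟨r, rfl, rfl⟩ := read_letter (by omega) hy
    refine after_wr_two fun u u' h hu => after_nil ?_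
    obtain ⟨t₁, rfl, rfl⟩ := write_letter (by omega) h hu
    refine ⟨ha, r, w, t₁ ++ [l], t₂, i, j, k, by simp, (cons.1 hr).2, hw,
      (append.1 ht₁).1.concat hl, (cons.1 ht₂).2, hcl, hjk, hok.loss ?_ le_rfl⟩
    have h₁ := Loss.supersede_append hu t₁ (t₂ ++ [a + 1])
    have h₂ := Loss.supersede_append hu t₁ r
    simpa using ((h₁.flatten_replicate (k + 1)).append_left w).append h₂
  | @compare_mark a ha =>
    obtain ⟨-, r, w, t₁, t₂, i, j, k, rfl, hr, hw, ht₁, ht₂, hcl, hjk, hok⟩ := hX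
    refine after_rd_two fun y hy => ?_
    obtain ⟨rfl, rfl⟩ := read_mark (ht₂.mono ha.le) hy
    refine after_rd_zero fun y hy => ?_
    obtain ⟨r, rfl, rfl⟩ := read_letter (by omega) hy
    refine after_wr_two fun u u' h _ => after_nil ?_
    subst h
    refine ⟨ha, r, w, u, i, j, k + 1, rfl, (cons.1 hr).2, hw, (append.1 ht₁).1, hcl, hjk,
      hok.loss ?_ le_rfl⟩
    have hu := (append.1 ht₁).2.mono (Nat.le_succ a)
    have h₁ := Loss.supersede_append hu u []
    have h₂ := Loss.supersede_append hu u r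
    simpa [List.replicate_succ' (n := k + 1)] using
      ((h₁.flatten_replicate (k + 1)).append_left w).append h₂
  | collate_mark ha =>
    obtain ⟨-, r, w, v, i, j, k, rfl, hr, hw, hv, hcl, hjk, hok⟩ := hX
    refine after_rd_one fun y hy => ?_
    obtain ⟨rfl, rfl⟩ := read_zeros_mark hy
    refine after_wr_one fun u u' h hu => after_nil ?_
    obtain ⟨m, hm, rfl⟩ := zeros_eq_append h
    refine ⟨ha, r, w, v, m, rfl, hr, hw, hv, ?_⟩
    rintro v' hv' rfl
    exact (hok.of_hardy_le (n' := k + 1) (by omega)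
      (by simpa using (hardy_contract ha hcl hv (.inr ⟨v', hv'⟩)).le)).le (by omega)
  | @restore_nil a ha =>
    obtain ⟨-, r, w, v, i, j, k, rfl, hr, hw, hv, hcl, hjk, hok⟩ := hX
    refine after_rd_one fun y hy => ?_
    obtain ⟨rfl, rfl⟩ := read_zeros_mark hy
    refine after_wr_one fun u u' h hu => ?_
    obtain ⟨m, hm, rfl⟩ := zeros_eq_append h
    refine after_rd_two fun y hy => ?_
    obtain ⟨rfl, rfl⟩ := read_mark (hv.mono ha.le) hy
    refine after_wr_two fun u u' h _ => ?_
    obtain ⟨rfl, rfl⟩ := List.append_eq_nil_iff.1 h.symm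
    refine after_wr_zero fun z z' h hz => ?_
    obtain ⟨w, rfl, rfl⟩ := write_letter (by omega) h hz
    refine after_wr_zero fun s s' h hs => after_nil ?_
    rw [List.append_assoc, List.cons_append] at h
    obtain ⟨w', hw', rfl⟩ := write_letter (by omega) h hs
    have hb : Below d (w' ++ s') := hw' ▸ (append.1 hw).1.concat ha.le
    refine ⟨r, w' ++ [a + 1], m, by simp, hr, (append.1 hb).1.concat ha, ?_⟩
    rintro rfl
    have h₁ := hok.of_hardy_le (n' := k + 1) (by omega)
      (by simpa using (hardy_contract ha hcl hv (.inl rfl)).le)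
    have h₂ := h₁.loss (x' := w' ++ s' ++ (a + 1) :: tail d (a + 1)) (by
      rw [← hw']; simpa using Loss.supersede_append hz w ((a + 1) :: tail d (a + 1))) le_rfl
    exact h₂.loss (by simpa using Loss.supersede_append hs w' (tail d (a + 1))) (by omega)
  | @restore_letter a l ha hl =>
    obtain ⟨-, r, w, v, j, rfl, hr, hw, hv, hok⟩ := hX
    refine after_rd_two fun y hy => ?_
    obtain ⟨v, rfl, rfl⟩ := read_letter (by omega) hy
    refine after_wr_zero fun z z' h hz => after_nil ?_
    obtain ⟨w, rfl, rfl⟩ := write_letter (by omega) h hz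
    refine ⟨ha, r, w ++ [l], v, j, by simp, hr, (append.1 hw).1.concat (by omega), (cons.1 hv).2,
      fun v' hv' h => (hok (l :: v') (by rw [hv']; rfl) h).loss ?_ le_rfl⟩
    simpa using Loss.supersede_append hz w (v ++ [a, a + 1] ++ r)
  | @restore_concat a ha =>
    obtain ⟨-, r, w, v, j, rfl, hr, hw, hv, hok⟩ := hX
    refine after_rd_two fun y hy => ?_
    obtain ⟨v, rfl, rfl⟩ := read_letter (by omega) hy
    refine after_wr_zero fun q q' h hq => ?_
    obtain ⟨w, rfl, rfl⟩ := write_letter (by omega) h hq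
    refine after_rd_two fun y hy => ?_
    obtain ⟨rfl, rfl⟩ := read_mark ((cons.1 hv).2.mono ha.le) hy
    refine after_wr_two fun u u' h _ => ?_
    obtain ⟨rfl, rfl⟩ := List.append_eq_nil_iff.1 h.symm
    refine after_wr_zero fun z z' h hz => ?_
    rw [List.append_assoc, List.cons_append] at h
    obtain ⟨w₁, hw₁, rfl⟩ := write_letter (by omega) h hz
    refine after_wr_zero fun s s' h hs => after_nil ?_
    rw [List.append_assoc, List.cons_append] at h
    obtain ⟨w₂, hw₂, rfl⟩ := write_letter (by omega) h hs
    have hb₁ : Below d (w₁ ++ z') := hw₁ ▸ (append.1 hw).1.concat ha.le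
    have hb₂ : Below d (w₂ ++ s') := hw₂ ▸ (append.1 hb₁).1.concat ha.le
    refine ⟨r, w₂ ++ [a + 1], j, by simp, hr, (append.1 hb₂).1.concat ha, fun h => ?_⟩
    have h₁ := (hok [] rfl h).loss (x' := w₁ ++ z' ++ a :: (a + 1) :: r) (by
      rw [← hw₁]; simpa using Loss.supersede_append hq w (a :: (a + 1) :: r)) le_rfl
    have h₂ := h₁.loss (x' := w₂ ++ s' ++ (a + 1) :: r) (by
      rw [← hw₂]; simpa using Loss.supersede_append hz w₁ ((a + 1) :: r)) le_rfl
    exact h₂.loss (by simpa using Loss.supersede_append hs w₂ r) le_rfl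

end HardyMachine

/-! ### Completeness -/

namespace HardyMachine

open OrdTerm HardyWord

/-- Carrying out operations without any loss. -/
def Exact : List Op → Chans → Chans → Prop
  | [], X, Y => X = Y
  | (i, false, l) :: ops, X, Y => ∃ y, X i = l :: y ∧ Exact ops (Function.update X i y) Y
  | (i, true, l) :: ops, X, Y => Exact ops (Function.update X i (X i ++ [l])) Y

/-- Lossless runs between phases. -/
def Run (d : ℕ) : Phase × Chans → Phase × Chans → Prop :=
  Relation.ReflTransGen fun s s' => ∃ ops, Edge d s.1 ops s'.1 ∧ Exact ops s.2 s'.2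

theorem Run.refl {d : ℕ} (s : Phase × Chans) : Run d s s := Relation.ReflTransGen.refl

theorem Run.trans {d : ℕ} {s₁ s₂ s₃ : Phase × Chans} (h₁ : Run d s₁ s₂) (h₂ : Run d s₂ s₃) :
    Run d s₁ s₃ := Relation.ReflTransGen.trans h₁ h₂

theorem Edge.run {d : ℕ} {p q : Phase} {ops : List Op} {X Y : Chans} (h : Edge d p ops q)
    (hX : Exact ops X Y) : Run d (p, X) (q, Y) := .single ⟨ops, h, hX⟩

theorem Edge.run_trans {d : ℕ} {p q : Phase} {ops : List Op} {X Y : Chans} {s : Phase × Chans}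
    (h : Edge d p ops q) (hX : Exact ops X Y) (hr : Run d (q, Y) s) : Run d (p, X) s :=
  (h.run hX).trans hr

theorem zeros_succ (n : ℕ) : zeros (n + 1) = 0 :: zeros n := rfl

theorem zeros_concat (n : ℕ) : zeros n ++ [0] = zeros (n + 1) := List.replicate_succ'.symm

variable {d a : ℕ} {o c t : List ℕ}

theorem run_scan {u : List ℕ} (hu : Below d u) :
    Run d (.scan, ![u ++ o, c, t]) (.scan, ![o ++ u, c, t]) := by
  induction u generalizing o with
  | nil => simpa using Run.refl _
  | cons l u ih =>
    refine (Edge.scan_letter (hu l (by simp))).run_trans (Y := ![u ++ (o ++ [l]), c, t])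
      (by simp [Exact, update_zero]) ?_
    simpa using ih (o := o ++ [l]) (Below.cons.1 hu).2

theorem run_load (ha : a < d) {v : List ℕ} (hv : Below a v) :
    Run d (.load a, ![v ++ o, c, t]) (.load a, ![o, c, t ++ v]) := by
  induction v generalizing t with
  | nil => simpa using Run.refl _
  | cons l v ih =>
    refine (Edge.load_letter ha (hv l (by simp))).run_trans (Y := ![v ++ o, c, t ++ [l]])
      (by simp [Exact, update_zero, update_two]) ?_
    simpa using ih (t := t ++ [l]) (Below.cons.1 hv).2

theorem run_copy (ha : a < d) {v : List ℕ} (hv : Below a v) :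
    Run d (.copy a, ![o, c, v ++ t]) (.copy a, ![o ++ v, c, t ++ v]) := by
  induction v generalizing o t with
  | nil => simpa using Run.refl _
  | cons l v ih =>
    refine (Edge.copy_letter ha (hv l (by simp))).run_trans (Y := ![o ++ [l], c, v ++ (t ++ [l])])
      (by simp [Exact, update_zero, update_two]) ?_
    simpa using ih (o := o ++ [l]) (t := t ++ [l]) (Below.cons.1 hv).2

theorem run_copied (ha : a < d) {v : List ℕ} (hv : Below a v) (i j : ℕ) :
    Run d (.copied a, ![o, zeros i ++ (d + 1) :: zeros j, v ++ [d + 1]])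
      (.copied a, ![o ++ (List.replicate i (v ++ [a + 1])).flatten, (d + 1) :: zeros (j + i),
        v ++ [d + 1]]) := by
  induction i generalizing o j with
  | zero => simpa using Run.refl _
  | succ i ih =>
    refine (Edge.copied_zero ha).run_trans
      (Y := ![o, zeros i ++ (d + 1) :: zeros (j + 1), v ++ [d + 1]])
      (by simp [Exact, update_one, zeros_succ, ← zeros_concat j]) ?_
    refine (run_copy ha hv).trans ((Edge.copy_mark ha).run_trans
      (Y := ![o ++ v ++ [a + 1], zeros i ++ (d + 1) :: zeros (j + 1), v ++ [d + 1]])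
      (by simp [Exact, update_zero, update_two]) ?_)
    rw [show j + (i + 1) = j + 1 + i by omega]
    simpa [List.replicate_succ] using ih (o := o ++ v ++ [a + 1]) (j + 1)

theorem run_wipe (ha : a < d) {v : List ℕ} (hv : Below a v) :
    Run d (.wipe a, ![o, c, v ++ t]) (.wipe a, ![o, c, t]) := by
  induction v with
  | nil => exact Run.refl _
  | cons l v ih =>
    exact (Edge.wipe_letter ha (hv l (by simp))).run_trans (Y := ![o, c, v ++ t])
      (by simp [Exact, update_two]) (ih (Below.cons.1 hv).2)

theorem run_finish : ∀ (k : ℕ) {e : ℕ} {o : List ℕ}, e + k = d →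
    Run d (.finish e, ![tail d e ++ o, c, t]) (.finish d, ![o ++ tail d e, c, t])
  | 0, e, o, h => by
    obtain rfl : e = d := h
    simpa using Run.refl _
  | k + 1, e, o, h => by
    rw [tail_of_lt (by omega)]
    refine (Edge.finish_letter (by omega)).run_trans
      (Y := ![tail d (e + 1) ++ (o ++ [e + 1]), c, t]) (by simp [Exact, update_zero]) ?_
    simpa using run_finish k (o := o ++ [e + 1]) (show e + 1 + k = d by omega)

theorem run_compare (ha : a < d) {v : List ℕ} (hv : Below a v) :
    Run d (.compare a, ![v ++ o, c, v ++ t]) (.compare a, ![o, c, t ++ v]) := by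
  induction v generalizing t with
  | nil => simpa using Run.refl _
  | cons l v ih =>
    refine (Edge.compare_letter ha (hv l (by simp))).run_trans (Y := ![v ++ o, c, v ++ (t ++ [l])])
      (by simp [Exact, update_zero, update_two]) ?_
    simpa using ih (t := t ++ [l]) (Below.cons.1 hv).2

theorem run_collate (ha : a < d) {v : List ℕ} (hv : Below a v) (i j : ℕ) :
    Run d (.collate a, ![(List.replicate i (v ++ [a + 1])).flatten ++ o,
        zeros i ++ (d + 1) :: zeros j, v ++ [d + 1]])
      (.collate a, ![o, (d + 1) :: zeros (j + i), v ++ [d + 1]]) := by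
  induction i generalizing j with
  | zero => simpa using Run.refl _
  | succ i ih =>
    refine (Edge.collate_zero ha).run_trans
      (Y := ![v ++ ([a + 1] ++ ((List.replicate i (v ++ [a + 1])).flatten ++ o)),
        zeros i ++ (d + 1) :: zeros (j + 1), v ++ [d + 1]])
      (by simp [Exact, update_one, ← zeros_concat j, List.replicate_succ]) ?_
    refine (run_compare ha hv).trans ((Edge.compare_mark ha).run_trans
      (Y := ![(List.replicate i (v ++ [a + 1])).flatten ++ o,
        zeros i ++ (d + 1) :: zeros (j + 1), v ++ [d + 1]])
      (by simp [Exact, update_zero, update_two]) ?_)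
    rw [show j + (i + 1) = j + 1 + i by omega]
    simpa using ih (j + 1)

theorem run_restore (ha : a < d) {v : List ℕ} (hv : Below a v) :
    Run d (.restore a, ![o, c, v ++ t]) (.restore a, ![o ++ v, c, t]) := by
  induction v generalizing o with
  | nil => simpa using Run.refl _
  | cons l v ih =>
    refine (Edge.restore_letter ha (hv l (by simp))).run_trans (Y := ![o ++ [l], c, v ++ t])
      (by simp [Exact, update_zero, update_two]) ?_
    simpa using ih (o := o ++ [l]) (Below.cons.1 hv).2

theorem run_check {x : List ℕ} (hx : Below d x) : ∀ {e : ℕ} {o : List ℕ}, e ≤ d →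
    List.IsChain StepLe (e :: (x ++ [d + 1])) →
    Run d (.check e, ![x ++ o, c, t]) (.check d, ![o ++ x, c, t]) := by
  induction x with
  | nil =>
    intro e o he hc
    have h : d + 1 ≤ e + 1 := by simpa [StepLe] using hc
    obtain rfl : e = d := by omega
    simpa using Run.refl _
  | cons l x ih =>
    intro e o he hc
    rw [List.cons_append, List.isChain_cons_cons] at hc
    obtain ⟨hl, hx⟩ := Below.cons.1 hx
    refine (Edge.check_letter he hl hc.1).run_trans (Y := ![x ++ (o ++ [l]), c, t])
      (by simp [Exact, update_zero]) ?_
    simpa using ih hx (o := o ++ [l]) hl hc.2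

theorem run_count (i j : ℕ) : Run d (.count, ![o, zeros i ++ (d + 1) :: zeros j, t])
    (.count, ![o, (d + 1) :: zeros (j + i), t]) := by
  induction i generalizing j with
  | zero => exact Run.refl _
  | succ i ih =>
    refine Edge.count_zero.run_trans (Y := ![o, zeros i ++ (d + 1) :: zeros (j + 1), t])
      (by simp [Exact, update_one, zeros_succ, ← zeros_concat j]) ?_
    rw [show j + (i + 1) = j + 1 + i by omega]
    simpa using ih (j + 1)

/-- The configuration of `main` that holds the word `x` and the counter `n`. -/
def mainConf (d : ℕ) (x : List ℕ) (n : ℕ) : Phase × Chans :=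
  (.main, ![x ++ [d + 1], zeros n ++ [d + 1], [d + 1]])

theorem run_count_main {x : List ℕ} (i j : ℕ) :
    Run d (.count, ![x ++ [d + 1], zeros i ++ (d + 1) :: zeros j, [d + 1]])
      (mainConf d x (i + j)) := by
  refine (run_count i j).trans (Edge.count_mark.run ?_)
  simp [Exact, update_one, update_two, add_comm]

theorem run_start (x : List ℕ) (n : ℕ) : Run d (mainConf d x (n + 1))
    (.scan, ![x ++ [d + 1], zeros n ++ [d + 1, 0], [d + 1]]) :=
  Edge.start.run (by simp [Exact, update_one, zeros_succ])

/-- The initial verification leaves valid contents unchanged. -/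
theorem run_check_main {x : List ℕ} (hx : Below d x)
    (hc : List.IsChain StepLe (x ++ [d + 1])) (n : ℕ) :
    Run d (.check d, ![x ++ [d + 1], zeros (n + 1) ++ [d + 1], [d + 1]])
      (mainConf d x (n + 1)) := by
  refine (run_check hx le_rfl ?_).trans (Edge.check_mark.run_trans
    (Y := ![x ++ [d + 1], zeros n ++ (d + 1) :: zeros 1, [d + 1]]) ?_ (run_count_main n 1))
  · cases x with
    | nil => simp [StepLe]
    | cons l x =>
      refine .cons_cons ?_ hc
      have := hx l (by simp)
      unfold StepLe
      omega
  · simp [Exact, update_zero, update_one, zeros_succ]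

theorem run_pop {x : List ℕ} (hx : Below d x) (n : ℕ) :
    Run d (mainConf d (x ++ [d]) (n + 1)) (mainConf d x (n + 2)) := by
  have h := run_scan (o := [d, d + 1]) (c := zeros n ++ [d + 1, 0]) (t := [d + 1]) hx
  refine (run_start _ n).trans (Run.trans (by simpa using h) (Edge.pop.run_trans
    (Y := ![x ++ [d + 1], zeros n ++ (d + 1) :: zeros 2, [d + 1]]) ?_ (run_count_main n 2)))
  simp [Exact, update_zero, update_one, zeros_succ]

theorem run_push {x : List ℕ} (hx : Below d x) (hxd : x = [] ∨ ∃ x', x = x' ++ [d]) (n : ℕ) :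
    Run d (mainConf d x (n + 2)) (mainConf d (x ++ [d]) (n + 1)) := by
  rcases hxd with rfl | ⟨x, rfl⟩
  · refine Edge.push_nil.run_trans
      (Y := ![[] ++ [d] ++ [d + 1], zeros n ++ (d + 1) :: zeros 1, [d + 1]]) ?_ (run_count_main n 1)
    simp [Exact, update_zero, update_one, zeros_succ]
  · have h := run_scan (o := [d, d + 1]) (c := zeros (n + 1) ++ [d + 1, 0]) (t := [d + 1])
      (Below.append.1 hx).1
    refine (run_start _ (n + 1)).trans (Run.trans (by simpa using h) (Edge.push_concat.run_trans
      (Y := ![x ++ [d] ++ [d] ++ [d + 1], zeros n ++ (d + 1) :: zeros 1, [d + 1]]) ?_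
        (run_count_main n 1)))
    simp [Exact, update_zero, update_one, zeros_succ]

theorem run_main_load (ha : a < d) {u v r : List ℕ} (hu : Below d u)
    (hua : u = [] ∨ ∃ u' l, u = u' ++ [l] ∧ a + 1 ≤ l) (hv : Below a v) (n : ℕ) :
    Run d (mainConf d (u ++ v ++ r) (n + 1))
      (.load a, ![r ++ (d + 1) :: u, zeros n ++ [d + 1, 0], v]) := by
  suffices h : Run d (mainConf d (u ++ v ++ r) (n + 1))
      (.load a, ![v ++ (r ++ (d + 1) :: u), zeros n ++ [d + 1, 0], []]) from
    h.trans (by simpa using run_load (t := []) ha hv)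
  rcases hua with rfl | ⟨u, l, rfl, hl⟩
  · exact (Edge.load_nil ha).run (by simp [Exact, update_one, update_two, zeros_succ])
  · have hu' := Below.append.1 hu
    have h := run_scan (o := l :: (v ++ r ++ [d + 1])) (c := zeros n ++ [d + 1, 0]) (t := [d + 1])
      hu'.1
    refine (run_start _ n).trans (Run.trans (by simpa using h)
      ((Edge.load_concat (hu'.2 l (by simp)) hl).run ?_))
    simp [Exact, update_zero, update_two]

theorem run_finish_main (ha : a < d) (w : List ℕ) (n : ℕ) :
    Run d (.finish (a + 1), ![tail d (a + 1) ++ (d + 1) :: w, zeros n ++ [d + 1], [d + 1]])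
      (mainConf d (w ++ tail d (a + 1)) n) := by
  refine (run_finish (d - (a + 1)) (by omega)).trans (Edge.finish_mark.run ?_)
  simp [Exact, update_zero]

theorem run_expand (ha : a < d) {u v : List ℕ} (hu : Below d u)
    (hua : u = [] ∨ ∃ u' l, u = u' ++ [l] ∧ a + 1 ≤ l) (hv : Below a v) (n : ℕ) :
    Run d (mainConf d (u ++ v ++ [a, a + 1] ++ tail d (a + 1)) (n + 1))
      (mainConf d (u ++ (List.replicate (n + 1) (v ++ [a + 1])).flatten ++ tail d (a + 1))
        (n + 1)) := by
  rw [List.append_assoc (u ++ v)]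
  refine (run_main_load ha hu hua hv n).trans ?_
  refine (Edge.expand ha).run_trans
    (Y := ![tail d (a + 1) ++ (d + 1) :: u, zeros n ++ (d + 1) :: zeros 1, v ++ [d + 1]])
    (by simp [Exact, update_zero, update_two]) ?_
  refine (run_copy ha hv).trans ((Edge.copy_mark ha).run_trans
    (Y := ![tail d (a + 1) ++ (d + 1) :: u ++ v ++ [a + 1], zeros n ++ (d + 1) :: zeros 1,
      v ++ [d + 1]]) (by simp [Exact, update_zero, update_two]) ?_)
  refine (run_copied ha hv n 1).trans ((Edge.copied_mark ha).run_trans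
    (Y := ![tail d (a + 1) ++ (d + 1) :: (u ++ (List.replicate (n + 1) (v ++ [a + 1])).flatten),
      zeros (n + 1) ++ [d + 1], v ++ [d + 1]])
    (by simp [Exact, update_one, List.replicate_succ, add_comm]) ?_)
  exact (run_wipe ha hv).trans ((Edge.wipe_mark ha).run_trans
    (by simp [Exact, update_two]) (run_finish_main ha _ (n + 1)))

theorem run_contract (ha : a < d) {u v : List ℕ} (hu : Below d u)
    (hua : u = [] ∨ ∃ u' l, u = u' ++ [l] ∧ a + 1 ≤ l) (hv : Below a v)
    (hva : v = [] ∨ ∃ v', v = v' ++ [a]) (n : ℕ) :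
    Run d (mainConf d (u ++ (List.replicate (n + 1) (v ++ [a + 1])).flatten ++ tail d (a + 1))
        (n + 1))
      (mainConf d (u ++ v ++ [a, a + 1] ++ tail d (a + 1)) (n + 1)) := by
  rw [show u ++ (List.replicate (n + 1) (v ++ [a + 1])).flatten ++ tail d (a + 1) = u ++ v ++
    ((a + 1) :: ((List.replicate n (v ++ [a + 1])).flatten ++ tail d (a + 1))) by
      simp [List.replicate_succ]]
  refine (run_main_load ha hu hua hv n).trans ?_
  refine (Edge.contract ha).run_trans
    (Y := ![(List.replicate n (v ++ [a + 1])).flatten ++ (tail d (a + 1) ++ (d + 1) :: u),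
      zeros n ++ (d + 1) :: zeros 1, v ++ [d + 1]])
    (by simp [Exact, update_zero, update_two]) ?_
  refine (run_collate ha hv n 1).trans ?_
  rcases hva with rfl | ⟨v, rfl⟩
  · refine (Edge.restore_nil ha).run_trans (Y := ![tail d (a + 1) ++
      (d + 1) :: (u ++ [a, a + 1]), zeros (n + 1) ++ [d + 1], [d + 1]])
      (by simp [Exact, update_zero, update_one, update_two, add_comm]) ?_
    simpa using run_finish_main ha (u ++ [a, a + 1]) (n + 1)
  · refine (Edge.collate_mark ha).run_trans (Y := ![tail d (a + 1) ++ (d + 1) :: u,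
      zeros (n + 1) ++ [d + 1], v ++ [a, d + 1]])
      (by simp [Exact, update_one, add_comm]) ?_
    refine (run_restore ha (Below.append.1 hv).1).trans ((Edge.restore_concat ha).run_trans
      (Y := ![tail d (a + 1) ++ (d + 1) :: (u ++ (v ++ [a]) ++ [a, a + 1]),
        zeros (n + 1) ++ [d + 1], [d + 1]]) (by simp [Exact, update_zero, update_two]) ?_)
    exact run_finish_main ha _ (n + 1)

theorem below_enc (d : ℕ) (α : OrdTerm) : Below d (enc (d + 1) α) :=
  fun _ h => Nat.lt_succ_iff.1 (lt_of_mem_enc h)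

/-- The machine computes the Hardy functions exactly, in both directions. -/
theorem run_hardy {α : OrdTerm} (hα : α < tower (d + 1)) (n : ℕ) :
    Run d (mainConf d (enc (d + 1) α) (n + 1)) (mainConf d [] (α.hardy (n + 1))) ∧
      Run d (mainConf d [] (α.hardy (n + 1))) (mainConf d (enc (d + 1) α) (n + 1)) := by
  induction ho : α.toOrdinal using WellFoundedLT.induction generalizing α n with
  | ind o ih =>
    subst ho
    have hfit := fits_of_lt _ _ hα
    rcases α with _ | ⟨γ, _ | ⟨δ, ε⟩⟩
    · rw [hardy_zero, enc_zero]
      exact ⟨.refl _, .refl _⟩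
    · have hlt : γ.toOrdinal < (addExp γ .zero).toOrdinal := by simp [toOrdinal]
      obtain ⟨h₁, h₂⟩ := ih _ hlt (hlt.trans hα) (n + 1) rfl
      have he : enc (d + 1) (.addExp γ .zero) = enc (d + 1) γ ++ [d] := by simp [enc]
      rw [hardy_addExp_zero, he]
      exact ⟨(run_pop (below_enc d γ) n).trans h₁,
        h₂.trans (run_push (below_enc d γ) (enc_eq_nil_or d γ) n)⟩
    · have hlt := toOrdinal_fund_lt γ (.addExp δ ε) (n + 1)
      obtain ⟨h₁, h₂⟩ := ih _ hlt (hlt.trans hα) n rfl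
      obtain ⟨u, v, a, ha, hv, hva, hu, he, hf⟩ := enc_limit hfit
      have hb : Below d u := by
        have := below_enc d (.addExp γ (.addExp δ ε))
        rw [he] at this
        simp only [Below.append] at this
        exact this.1.1.1
      rw [hf] at h₁ h₂
      rw [hardy_limit _ (by simp), he]
      exact ⟨(run_expand ha hb hu hv n).trans h₁, h₂.trans (run_contract ha hb hu hv hva n)⟩

end HardyMachine

/-! ### Numbering the states -/

namespace HardyMachine

open OrdTerm HardyWord Encodable

/-- Phases as pairs of numbers. -/
def Phase.num : Phase → ℕ × ℕ
  | .check e => (0, e)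
  | .count => (1, 0)
  | .main => (2, 0)
  | .scan => (3, 0)
  | .load a => (4, a)
  | .copy a => (5, a)
  | .copied a => (6, a)
  | .wipe a => (7, a)
  | .finish e => (8, e)
  | .collate a => (9, a)
  | .compare a => (10, a)
  | .restore a => (11, a)

theorem Phase.num_injective : Function.Injective Phase.num := by
  intro p q h
  cases p <;> cases q <;> simp_all [Phase.num]

/-- A control state: the operations still to be done, and the phase to be reached by them.  Its
number is its code as an element of an encodable type. -/
abbrev Node : Type := List Op × (ℕ × ℕ)

/-- The data of an edge: its source, its operations and its target. -/
abbrev EdgeData : Type := (ℕ × ℕ) × List Op × (ℕ × ℕ)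

/-- The data of a rule: state, channel, kind of operation, letter and next state. -/
abbrev RuleData : Type := ℕ × ℕ × Bool × ℕ × ℕ

/-- The edges that depend on `d` only. -/
def constEdges (d : ℕ) : List EdgeData :=
  [((0, d), [rd 0 (d + 1), wr 0 (d + 1), rd 1 0, wr 1 0], (1, 0)),
   ((1, 0), [rd 1 0, wr 1 0], (1, 0)),
   ((1, 0), [rd 1 (d + 1), wr 1 (d + 1), rd 2 (d + 1), wr 2 (d + 1)], (2, 0)),
   ((2, 0), [rd 1 0, wr 1 0], (3, 0)),
   ((3, 0), [rd 0 d, rd 0 (d + 1), wr 0 (d + 1), wr 1 0], (1, 0)),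
   ((2, 0), [rd 1 0, wr 1 0, rd 0 (d + 1), wr 0 d, wr 0 (d + 1), rd 1 0], (1, 0)),
   ((3, 0), [rd 0 d, wr 0 d, rd 0 (d + 1), wr 0 d, wr 0 (d + 1), rd 1 0], (1, 0)),
   ((8, d), [rd 0 (d + 1), wr 0 (d + 1)], (2, 0))]

/-- The edges that depend on a level `a < d`. -/
def levelEdges (d a : ℕ) : List EdgeData :=
  [((2, 0), [rd 1 0, wr 1 0, rd 2 (d + 1)], (4, a)),
   ((4, a), [rd 0 a, rd 0 (a + 1), wr 2 (d + 1)], (5, a)),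
   ((5, a), [rd 2 (d + 1), wr 0 (a + 1), wr 2 (d + 1)], (6, a)),
   ((6, a), [rd 1 0, wr 1 0], (5, a)),
   ((6, a), [rd 1 (d + 1), wr 1 (d + 1)], (7, a)),
   ((7, a), [rd 2 (d + 1), wr 2 (d + 1)], (8, a + 1)),
   ((8, a), [rd 0 (a + 1), wr 0 (a + 1)], (8, a + 1)),
   ((4, a), [rd 0 (a + 1), wr 2 (d + 1)], (9, a)),
   ((9, a), [rd 1 0, wr 1 0], (10, a)),
   ((10, a), [rd 2 (d + 1), rd 0 (a + 1), wr 2 (d + 1)], (9, a)),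
   ((9, a), [rd 1 (d + 1), wr 1 (d + 1)], (11, a)),
   ((9, a), [rd 1 (d + 1), wr 1 (d + 1), rd 2 (d + 1), wr 2 (d + 1), wr 0 a, wr 0 (a + 1)],
     (8, a + 1)),
   ((11, a), [rd 2 a, wr 0 a, rd 2 (d + 1), wr 2 (d + 1), wr 0 a, wr 0 (a + 1)], (8, a + 1))]

/-- The edges that depend on a level `a < d` and a letter `l ≤ a`. -/
def letterEdges (a l : ℕ) : List EdgeData :=
  [((4, a), [rd 0 l, wr 2 l], (4, a)),
   ((5, a), [rd 2 l, wr 0 l, wr 2 l], (5, a)),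
   ((7, a), [rd 2 l], (7, a)),
   ((10, a), [rd 2 l, rd 0 l, wr 2 l], (10, a)),
   ((11, a), [rd 2 l, wr 0 l], (11, a))]

/-- All edges of the program. -/
def edges (d : ℕ) : List EdgeData :=
  constEdges d ++
  (List.range d).flatMap (levelEdges d) ++
  (List.range (d + 1)).map (fun l => ((3, 0), [rd 0 l, wr 0 l], (3, 0))) ++
  (List.range (d + 1)).flatMap fun a => (List.range (d + 1)).flatMap fun l =>
    (if l ≤ a + 1 then [((0, a), [rd 0 l, wr 0 l], (0, l))] else []) ++
    (if a + 1 ≤ l then [((3, 0), [rd 0 l, wr 0 l, rd 2 (d + 1)], (4, a))] else []) ++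
    (if a < d ∧ l ≤ a then letterEdges a l else [])

theorem mem_edges {d : ℕ} {e : EdgeData} :
    e ∈ edges d ↔ ∃ p ops q, Edge d p ops q ∧ e = (p.num, ops, q.num) := by
  constructor
  · intro h
    simp only [edges, List.mem_append, List.mem_flatMap, List.mem_map, List.mem_range,
      List.mem_ite_nil_right, List.mem_singleton] at h
    rcases h with ((h | ⟨a, ha, h⟩) | ⟨l, hl, rfl⟩) |
      ⟨a, ha, l, hl, (⟨hal, rfl⟩ | ⟨hal, rfl⟩) | ⟨⟨ha', hal⟩, h⟩⟩
    · simp only [constEdges, List.mem_cons, List.not_mem_nil, or_false] at h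
      rcases h with rfl | rfl | rfl | rfl | rfl | rfl | rfl | rfl
      · exact ⟨_, _, _, .check_mark, rfl⟩
      · exact ⟨_, _, _, .count_zero, rfl⟩
      · exact ⟨_, _, _, .count_mark, rfl⟩
      · exact ⟨_, _, _, .start, rfl⟩
      · exact ⟨_, _, _, .pop, rfl⟩
      · exact ⟨_, _, _, .push_nil, rfl⟩
      · exact ⟨_, _, _, .push_concat, rfl⟩
      · exact ⟨_, _, _, .finish_mark, rfl⟩
    · simp only [levelEdges, List.mem_cons, List.not_mem_nil, or_false] at h
      rcases h with rfl | rfl | rfl | rfl | rfl | rfl | rfl | rfl | rfl | rfl | rfl | rfl | rfl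
      · exact ⟨_, _, _, .load_nil ha, rfl⟩
      · exact ⟨_, _, _, .expand ha, rfl⟩
      · exact ⟨_, _, _, .copy_mark ha, rfl⟩
      · exact ⟨_, _, _, .copied_zero ha, rfl⟩
      · exact ⟨_, _, _, .copied_mark ha, rfl⟩
      · exact ⟨_, _, _, .wipe_mark ha, rfl⟩
      · exact ⟨_, _, _, .finish_letter ha, rfl⟩
      · exact ⟨_, _, _, .contract ha, rfl⟩
      · exact ⟨_, _, _, .collate_zero ha, rfl⟩
      · exact ⟨_, _, _, .compare_mark ha, rfl⟩
      · exact ⟨_, _, _, .collate_mark ha, rfl⟩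
      · exact ⟨_, _, _, .restore_nil ha, rfl⟩
      · exact ⟨_, _, _, .restore_concat ha, rfl⟩
    · exact ⟨_, _, _, .scan_letter (Nat.lt_succ_iff.1 hl), rfl⟩
    · exact ⟨_, _, _, .check_letter (Nat.lt_succ_iff.1 ha) (Nat.lt_succ_iff.1 hl) hal, rfl⟩
    · exact ⟨_, _, _, .load_concat (Nat.lt_succ_iff.1 hl) hal, rfl⟩
    · simp only [letterEdges, List.mem_cons, List.not_mem_nil, or_false] at h
      rcases h with rfl | rfl | rfl | rfl | rfl
      · exact ⟨_, _, _, .load_letter ha' hal, rfl⟩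
      · exact ⟨_, _, _, .copy_letter ha' hal, rfl⟩
      · exact ⟨_, _, _, .wipe_letter ha' hal, rfl⟩
      · exact ⟨_, _, _, .compare_letter ha' hal, rfl⟩
      · exact ⟨_, _, _, .restore_letter ha' hal, rfl⟩
  · rintro ⟨p, ops, q, h, rfl⟩
    simp only [edges, List.mem_append, List.mem_flatMap, List.mem_map, List.mem_range,
      List.mem_ite_nil_right, List.mem_singleton]
    have hlev {e : EdgeData} {a : ℕ} (ha : a < d) (h : e ∈ levelEdges d a) :
        ∃ a < d, e ∈ levelEdges d a := ⟨a, ha, h⟩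
    cases h with
    | check_mark | count_zero | count_mark | start | pop | push_nil | push_concat | finish_mark =>
      exact .inl (.inl (.inl (by simp [constEdges, Phase.num])))
    | scan_letter hl => exact .inl (.inr ⟨_, Nat.lt_succ_iff.2 hl, rfl⟩)
    | check_letter he hl hel =>
      exact .inr ⟨_, Nat.lt_succ_iff.2 he, _, Nat.lt_succ_iff.2 hl, .inl (.inl ⟨hel, rfl⟩)⟩
    | load_concat hl hal =>
      exact .inr ⟨_, by omega, _, Nat.lt_succ_iff.2 hl, .inl (.inr ⟨hal, rfl⟩)⟩
    | load_letter ha hl | copy_letter ha hl | wipe_letter ha hl | compare_letter ha hl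
    | restore_letter ha hl =>
      exact .inr ⟨_, by omega, _, by omega, .inr ⟨⟨ha, hl⟩, by simp [letterEdges, Phase.num]⟩⟩
    | load_nil ha | expand ha | copy_mark ha | copied_zero ha | copied_mark ha | wipe_mark ha
    | finish_letter ha | contract ha | collate_zero ha | compare_mark ha | collate_mark ha
    | restore_nil ha | restore_concat ha =>
      exact .inl (.inl (.inr (hlev ha (by simp [levelEdges, Phase.num]))))

theorem Edge.letter_le {d : ℕ} {p q : Phase} {ops : List Op} (h : Edge d p ops q) :
    ∀ op ∈ ops, op.2.2 ≤ d + 1 := by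
  cases h <;> simp <;> omega

theorem Edge.ne_nil {d : ℕ} {p q : Phase} {ops : List Op} (h : Edge d p ops q) : ops ≠ [] := by
  cases h <;> simp

/-- The rule from the state `s` to the state `s'` by the operation `op`. -/
def ruleData (s : Node) (op : Op) (s' : Node) : RuleData :=
  (encode s, op.1, op.2.1, op.2.2, encode s')

/-- The rules that carry out `ops` on the way to the phase `q`. -/
def suffixRules (q : ℕ × ℕ) : List Op → List RuleData
  | [] => []
  | op :: ops => ruleData (op :: ops, q) op (ops, q) :: suffixRules q ops

/-- The rules of one edge. -/
def edgeRules (e : EdgeData) : List RuleData :=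
  e.2.1.head?.toList.map (fun op => ruleData ([], e.1) op (e.2.1.tail, e.2.2)) ++
    suffixRules e.2.2 e.2.1

/-- The rules of the machine. -/
def rules (d : ℕ) : List RuleData := (edges d).flatMap edgeRules

/-- The number of the state at the phase `p`. -/
def stateNum (p : Phase) : ℕ := encode (([], p.num) : Node)

/-- The number of states, which exceeds the numbers of all states in use. -/
def size (d : ℕ) : ℕ :=
  (rules d).foldr (fun r m => max (max r.1 r.2.2.2.2) m)
    (max (stateNum (.check d)) (stateNum .main)) + 1

theorem stateNum_lt_size_of_mem {d : ℕ} {r : RuleData} (h : r ∈ rules d) :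
    r.1 < size d ∧ r.2.2.2.2 < size d := by
  unfold size
  generalize rules d = L at h
  induction L with
  | nil => exact absurd h List.not_mem_nil
  | cons r' L ih =>
    rw [List.foldr_cons]
    rcases List.mem_cons.1 h with rfl | h
    · omega
    · have := ih h
      omega

theorem stateNum_lt_size (d : ℕ) : stateNum (.check d) < size d ∧ stateNum .main < size d := by
  unfold size
  induction rules d with
  | nil => rw [List.foldr_nil]; omega
  | cons r' L ih => rw [List.foldr_cons]; omega

theorem mem_suffixRules {q : ℕ × ℕ} {ops : List Op} {r : RuleData} : r ∈ suffixRules q ops ↔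
    ∃ op rest, (op :: rest) <:+ ops ∧ r = ruleData (op :: rest, q) op (rest, q) := by
  induction ops with
  | nil => simp [suffixRules]
  | cons op ops ih =>
    rw [suffixRules, List.mem_cons, ih]
    constructor
    · rintro (rfl | ⟨op', rest, h, rfl⟩)
      · exact ⟨op, ops, List.suffix_rfl, rfl⟩
      · exact ⟨op', rest, h.trans (List.suffix_cons _ _), rfl⟩
    · rintro ⟨op', rest, h, rfl⟩
      rcases List.suffix_cons_iff.1 h with h | h
      · obtain ⟨rfl, rfl⟩ := List.cons.inj h
        exact .inl rfl
      · exact .inr ⟨op', rest, h, rfl⟩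

theorem mem_rules {d : ℕ} {r : RuleData} : r ∈ rules d ↔
    (∃ p op rest q, Edge d p (op :: rest) q ∧
      r = ruleData ([], p.num) op (rest, q.num)) ∨
    ∃ p ops q op rest, Edge d p ops q ∧ (op :: rest) <:+ ops ∧
      r = ruleData (op :: rest, q.num) op (rest, q.num) := by
  simp only [rules, List.mem_flatMap, mem_edges, edgeRules, List.mem_append, mem_suffixRules,
    List.mem_map, Option.mem_toList]
  constructor
  · rintro ⟨_, ⟨p, ops, q, h, rfl⟩, ⟨op, hop, rfl⟩ | ⟨op, rest, hs, rfl⟩⟩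
    · obtain ⟨rest, rfl⟩ : ∃ rest, ops = op :: rest := by
        cases ops with
        | nil => simp at hop
        | cons op' rest => simp at hop; exact ⟨rest, by rw [hop]⟩
      exact .inl ⟨p, op, rest, q, h, rfl⟩
    · exact .inr ⟨p, ops, q, op, rest, h, hs, rfl⟩
  · rintro (⟨p, op, rest, q, h, rfl⟩ | ⟨p, ops, q, op, rest, h, hs, rfl⟩)
    · exact ⟨_, ⟨p, _, q, h, rfl⟩, .inl ⟨op, rfl, rfl⟩⟩
    · exact ⟨_, ⟨p, ops, q, h, rfl⟩, .inr ⟨op, rest, hs, rfl⟩⟩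

/-! ### Computability -/

section Primrec

variable {α : Type} [Primcodable α] {d a l : α → ℕ}

theorem primrec_constEdges (hd : Primrec d) : Primrec fun x => constEdges (d x) := by
  unfold constEdges
  repeat first
    | exact Primrec.const _ | assumption | refine Primrec.list_cons.comp ?_ ?_
    | refine Primrec.pair ?_ ?_ | refine Primrec.succ.comp ?_

theorem primrec_levelEdges (hd : Primrec d) (ha : Primrec a) :
    Primrec fun x => levelEdges (d x) (a x) := by
  unfold levelEdges
  repeat first
    | exact Primrec.const _ | assumption | refine Primrec.list_cons.comp ?_ ?_
    | refine Primrec.pair ?_ ?_ | refine Primrec.succ.comp ?_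

theorem primrec_letterEdges (ha : Primrec a) (hl : Primrec l) :
    Primrec fun x => letterEdges (a x) (l x) := by
  unfold letterEdges
  repeat first
    | exact Primrec.const _ | assumption | refine Primrec.list_cons.comp ?_ ?_
    | refine Primrec.pair ?_ ?_ | refine Primrec.succ.comp ?_

theorem primrec_checkEdge (ha : Primrec a) (hl : Primrec l) : Primrec fun x =>
    ([((0, a x), [rd 0 (l x), wr 0 (l x)], (0, l x))] : List EdgeData) := by
  repeat first
    | exact Primrec.const _ | assumption | refine Primrec.list_cons.comp ?_ ?_
    | refine Primrec.pair ?_ ?_ | refine Primrec.succ.comp ?_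

theorem primrec_scanEdge (hl : Primrec l) : Primrec fun x =>
    (((3, 0), [rd 0 (l x), wr 0 (l x)], (3, 0)) : EdgeData) := by
  repeat first
    | exact Primrec.const _ | assumption | refine Primrec.list_cons.comp ?_ ?_
    | refine Primrec.pair ?_ ?_ | refine Primrec.succ.comp ?_

theorem primrec_loadEdge (hd : Primrec d) (ha : Primrec a) (hl : Primrec l) : Primrec fun x =>
    ([((3, 0), [rd 0 (l x), wr 0 (l x), rd 2 (d x + 1)], (4, a x))] : List EdgeData) := by
  repeat first
    | exact Primrec.const _ | assumption | refine Primrec.list_cons.comp ?_ ?_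
    | refine Primrec.pair ?_ ?_ | refine Primrec.succ.comp ?_

theorem primrec_edges : Primrec edges := by
  have hr : Primrec fun d : ℕ => List.range (d + 1) := Primrec.list_range.comp Primrec.succ
  have hd : Primrec fun x : (ℕ × ℕ) × ℕ => x.1.1 := Primrec.fst.comp Primrec.fst
  have ha : Primrec fun x : (ℕ × ℕ) × ℕ => x.1.2 := Primrec.snd.comp Primrec.fst
  have hl : Primrec fun x : (ℕ × ℕ) × ℕ => x.2 := Primrec.snd
  unfold edges
  exact Primrec.list_append.comp (Primrec.list_append.comp (Primrec.list_append.comp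
    (primrec_constEdges Primrec.id) (Primrec.list_flatMap Primrec.list_range
      (primrec_levelEdges Primrec.fst Primrec.snd)))
      (Primrec.list_map hr (primrec_scanEdge Primrec.snd)))
    (Primrec.list_flatMap hr (Primrec.list_flatMap (hr.comp Primrec.fst)
      (Primrec.list_append.comp (Primrec.list_append.comp
        (Primrec.ite (Primrec.nat_le.comp hl (Primrec.succ.comp ha)) (primrec_checkEdge ha hl)
          (Primrec.const _))
        (Primrec.ite (Primrec.nat_le.comp (Primrec.succ.comp ha) hl) (primrec_loadEdge hd ha hl)
          (Primrec.const _)))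
        (Primrec.ite ((Primrec.nat_lt.comp ha hd).and (Primrec.nat_le.comp hl ha))
          (primrec_letterEdges ha hl) (Primrec.const _)))))

theorem primrec_ruleData {s s' : α → Node} {op : α → Op} (hs : Primrec s) (ho : Primrec op)
    (hs' : Primrec s') : Primrec fun x => ruleData (s x) (op x) (s' x) :=
  (Primrec.encode.comp hs).pair ((Primrec.fin_val.comp (Primrec.fst.comp ho)).pair
    ((Primrec.fst.comp (Primrec.snd.comp ho)).pair ((Primrec.snd.comp (Primrec.snd.comp ho)).pair
      (Primrec.encode.comp hs'))))

theorem primrec_suffixRules : Primrec₂ suffixRules := by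
  have h : Primrec₂ fun (x : (ℕ × ℕ) × List Op) (y : Op × List Op × List RuleData) =>
      ruleData (y.1 :: y.2.1, x.1) y.1 (y.2.1, x.1) :: y.2.2 := by
    have hq : Primrec fun x : ((ℕ × ℕ) × List Op) × (Op × List Op × List RuleData) => x.1.1 :=
      Primrec.fst.comp Primrec.fst
    have ho : Primrec fun x : ((ℕ × ℕ) × List Op) × (Op × List Op × List RuleData) => x.2.1 :=
      Primrec.fst.comp Primrec.snd
    have hl : Primrec fun x : ((ℕ × ℕ) × List Op) × (Op × List Op × List RuleData) => x.2.2.1 :=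
      Primrec.fst.comp (Primrec.snd.comp Primrec.snd)
    exact Primrec.list_cons.comp (primrec_ruleData ((Primrec.list_cons.comp ho hl).pair hq) ho
      (hl.pair hq)) (Primrec.snd.comp (Primrec.snd.comp Primrec.snd))
  refine (Primrec.list_rec (f := fun x : (ℕ × ℕ) × List Op => x.2) Primrec.snd
    (Primrec.const []) h).of_eq fun ⟨q, ops⟩ => ?_
  induction ops with
  | nil => rfl
  | cons op ops ih => simp only [suffixRules] at ih ⊢; rw [← ih]

theorem primrec_rules : Primrec rules := by
  refine Primrec.list_flatMap primrec_edges ?_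
  have hp : Primrec fun x : ℕ × EdgeData => x.2.1 := Primrec.fst.comp Primrec.snd
  have ho : Primrec fun x : ℕ × EdgeData => x.2.2.1 :=
    Primrec.fst.comp (Primrec.snd.comp Primrec.snd)
  have hq : Primrec fun x : ℕ × EdgeData => x.2.2.2 :=
    Primrec.snd.comp (Primrec.snd.comp Primrec.snd)
  refine Primrec.list_append.comp (Primrec.list_map
    (Primrec.optionToList.comp (Primrec.list_head?.comp ho)) ?_) (primrec_suffixRules.comp hq ho)
  exact primrec_ruleData ((Primrec.const []).pair (hp.comp Primrec.fst)) Primrec.snd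
    ((Primrec.list_tail.comp (ho.comp Primrec.fst)).pair (hq.comp Primrec.fst))

theorem primrec_stateNum_check : Primrec fun d => stateNum (.check d) :=
  Primrec.encode.comp ((Primrec.const []).pair ((Primrec.const 0).pair Primrec.id))

theorem primrec_foldr_max {L : α → List RuleData} {f : α → ℕ} (hL : Primrec L) (hf : Primrec f) :
    Primrec fun x => (L x).foldr (fun r m => max (max r.1 r.2.2.2.2) m) (f x) + 1 := by
  have hr : Primrec fun x : α × (RuleData × ℕ) => x.2.1 := Primrec.fst.comp Primrec.snd
  have hm : Primrec₂ fun (_ : α) (y : RuleData × ℕ) => max (max y.1.1 y.1.2.2.2.2) y.2 :=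
    Primrec.nat_max.comp (Primrec.nat_max.comp (Primrec.fst.comp hr)
      (Primrec.snd.comp (Primrec.snd.comp (Primrec.snd.comp (Primrec.snd.comp hr)))))
      (Primrec.snd.comp Primrec.snd)
  exact Primrec.succ.comp (Primrec.list_foldr hL hf hm)

theorem primrec_max_const {f : α → ℕ} (hf : Primrec f) (c : ℕ) :
    Primrec fun x => max (f x) c :=
  Primrec.nat_max.comp hf (Primrec.const c)

theorem primrec_size : Primrec size :=
  primrec_foldr_max primrec_rules (primrec_max_const primrec_stateNum_check _)

end Primrec

end HardyMachine

/-! ### The weak Hardy computer -/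

namespace HardyMachine

open OrdTerm HardyWord Encodable HardyPCS

/-- The weak Hardy computer, which is both complete and inv-complete. -/
def machine (d : ℕ) : HardyPCS d where
  numStates := size d
  rules := {δ | describeRule δ ∈ rules d}
  pInit := ⟨stateNum (.check d), (stateNum_lt_size d).1⟩
  pFinal := ⟨stateNum .main, (stateNum_lt_size d).2⟩

/-- The listed rules stay within the states, channels and letters of the machine. -/
theorem exists_describeRule_eq {d : ℕ} {r : RuleData} (h : r ∈ rules d) :
    ∃ δ : PCSRule (d + 1) 3 (size d), describeRule δ = r := by
  obtain ⟨h₁, h₂⟩ := stateNum_lt_size_of_mem h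
  have key (op : Op) (h : op.2.2 ≤ d + 1) (s s' : Node) (h₁ : encode s < size d)
      (h₂ : encode s' < size d) :
      ∃ δ : PCSRule (d + 1) 3 (size d), describeRule δ = ruleData s op s' := by
    obtain ⟨i, w, l⟩ := op
    cases w
    · exact ⟨(⟨_, h₁⟩, i, .read, ⟨l, Nat.lt_succ_iff.2 h⟩, ⟨_, h₂⟩), rfl⟩
    · exact ⟨(⟨_, h₁⟩, i, .write, ⟨l, Nat.lt_succ_iff.2 h⟩, ⟨_, h₂⟩), rfl⟩
  rcases mem_rules.1 h with ⟨p, op, rest, q, he, rfl⟩ | ⟨p, ops, q, op, rest, he, hs, rfl⟩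
  · exact key op (he.letter_le op (by simp)) _ _ h₁ h₂
  · exact key op (he.letter_le op (hs.subset (by simp))) _ _ h₁ h₂

theorem uniformlyGenerated_machine : UniformlyGenerated machine := by
  refine ⟨fun d => (size d, rules d, stateNum (.check d), stateNum .main),
    (primrec_size.pair (primrec_rules.pair (primrec_stateNum_check.pair
      (Primrec.const _)))).to_comp, fun d => ⟨rfl, fun r => ⟨fun h => ?_, ?_⟩, rfl⟩⟩
  · obtain ⟨δ, rfl⟩ := exists_describeRule_eq h
    exact ⟨δ, h, rfl⟩
  · rintro ⟨δ, h, rfl⟩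
    exact h

variable {d : ℕ}

/-- Contents over `Fin (d + 2)` as contents over `ℕ`. -/
def vals (X : Fin 3 → Word d) : Chans := fun i => (X i).map Fin.val

theorem vals_update (X : Fin 3 → Word d) (i : Fin 3) (y : Word d) :
    vals (Function.update X i y) = Function.update (vals X) i (y.map Fin.val) := by
  funext j
  by_cases h : j = i
  · subst h; simp [vals]
  · simp [vals, h]

/-- The invariant at an arbitrary control state. -/
def StateInv (d : ℕ) (x₀ y₀ z₀ : List ℕ) (n : ℕ) (X : Chans) : Prop :=
  ∃ (rest : List Op) (p : Phase), n = encode ((rest, p.num) : Node) ∧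
    After rest (Inv d x₀ y₀ z₀ p) X

theorem StateInv.of_mem_rules {x₀ y₀ z₀ : List ℕ} {n n' : ℕ} {op : Op} {X X' : Chans}
    (h : StateInv d x₀ y₀ z₀ n X) (hr : (n, op.1.val, op.2.1, op.2.2, n') ∈ rules d)
    (hs : OpStep op X X') : StateInv d x₀ y₀ z₀ n' X' := by
  obtain ⟨rest, p, rfl, hX⟩ := h
  rcases mem_rules.1 hr with ⟨p', op', rest', q, he, h⟩ | ⟨p', ops, q, op', rest', he, -, h⟩
  · simp only [ruleData, Prod.mk.injEq, encode_inj] at h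
    obtain ⟨⟨rfl, h⟩, h₁, h₂, h₃, rfl⟩ := h
    obtain rfl : op = op' := Prod.ext (Fin.ext h₁) (Prod.ext h₂ h₃)
    obtain rfl := Phase.num_injective h
    exact ⟨rest', q, rfl, he.sound hX _ hs⟩
  · simp only [ruleData, Prod.mk.injEq, encode_inj] at h
    obtain ⟨⟨rfl, h⟩, h₁, h₂, h₃, rfl⟩ := h
    obtain rfl : op = op' := Prod.ext (Fin.ext h₁) (Prod.ext h₂ h₃)
    obtain rfl := Phase.num_injective h
    exact ⟨rest', p, rfl, hX _ hs⟩

theorem StateInv.reaches {x₀ y₀ z₀ : List ℕ} {s s' : (machine d).toPCS.Conf}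
    (h : StateInv d x₀ y₀ z₀ s.1 (vals s.2)) (hr : (machine d).toPCS.Reaches s s') :
    StateInv d x₀ y₀ z₀ s'.1 (vals s'.2) := by
  induction hr with
  | refl => exact h
  | tail _ hs ih =>
    cases hs with
    | read q q' i a X y hrule hX =>
      refine ih.of_mem_rules (op := rd i a) hrule ?_
      rw [vals_update]
      exact .rd (by simp [vals, hX])
    | write q q' i a X z z' hrule hX hz =>
      refine ih.of_mem_rules (op := wr i a) hrule ?_
      rw [vals_update, List.map_append]
      refine .wr (z' := z'.map Fin.val) (by simp [vals, hX]) ?_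
      simpa using hz

theorem vals_mark (x y z : Word d) : vals ![mark x, mark y, mark z]
    = ![x.map Fin.val ++ [d + 1], y.map Fin.val ++ [d + 1], z.map Fin.val ++ [d + 1]] := by
  funext i
  fin_cases i <;> simp [vals, mark]

theorem below_of_unmarked {x : Word d} (h : Unmarked x) : Below d (x.map Fin.val) := by
  intro b hb
  obtain ⟨c, hc, rfl⟩ := List.mem_map.1 hb
  by_contra hlt
  refine h ?_
  rwa [show Fin.last (d + 1) = c from Fin.ext (by rw [Fin.val_last]; omega)]

theorem exists_mark_of_map_val {x : Word d} {y : List ℕ} (hy : Below d y)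
    (h : x.map Fin.val = y ++ [d + 1]) : ∃ x', Unmarked x' ∧ x = mark x' := by
  obtain ⟨x', x'', rfl, rfl, h''⟩ := List.map_eq_append_iff.1 h
  obtain ⟨b, rfl, hb⟩ := List.map_eq_singleton_iff.1 h''
  refine ⟨x', fun hm => ?_, ?_⟩
  · have := hy _ (List.mem_map_of_mem hm)
    rw [Fin.val_last] at this
    omega
  · rw [mark, show b = Fin.last (d + 1) from Fin.ext hb]

/-- Every run between the distinguished states obeys the invariant of `main`. -/
theorem inv_main_of_computes {x y z u v w : Word d} (hx : Unmarked x) (hy : Unmarked y)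
    (hz : Unmarked z) (h : (machine d).Computes (mark x) (mark y) (mark z) u v w) :
    Inv d (x.map Fin.val) (y.map Fin.val) (z.map Fin.val) .main (vals ![u, v, w]) := by
  have h₀ : StateInv d (x.map Fin.val) (y.map Fin.val) (z.map Fin.val) (machine d).pInit
      (vals ![mark x, mark y, mark z]) := by
    rw [vals_mark]
    exact ⟨[], .check d, rfl, x.map Fin.val, [], rfl, below_of_unmarked hx, Below.nil,
      below_of_unmarked hy, below_of_unmarked hz, id, fun _ => le_rfl⟩
  obtain ⟨rest, p, hp, hX⟩ := h₀.reaches h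
  obtain ⟨rfl, hp'⟩ := Prod.mk.inj (encode_injective (show encode (([], Phase.main.num) : Node) = _
    from hp))
  obtain rfl := Phase.num_injective hp'
  exact hX

theorem safe_machine (d : ℕ) : (machine d).Safe := by
  intro x y z u v w hx hy hz h
  obtain ⟨x', n, hX, hx', ⟨hc, ⟨k, hk⟩, hz'⟩, -⟩ := inv_main_of_computes hx hy hz h
  refine ⟨?_, ⟨k + 1, Nat.succ_pos k, ?_⟩, by simpa using hz',
    exists_mark_of_map_val hx' (congrFun hX 0),
    exists_mark_of_map_val (below_zeros d n) (congrFun hX 1),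
    exists_mark_of_map_val (y := []) Below.nil (congrFun hX 2)⟩
  · refine mem_codeLang_of_isChain (by omega) (fun b hb => ?_) hc.tail
    exact Nat.lt_succ_iff.2 (below_of_unmarked hx _ (List.mem_map_of_mem hb))
  · refine List.map_injective_iff.2 Fin.val_injective ?_
    rw [hk, counter, List.map_replicate]
    rfl

theorem unmarked_ordCode (d : ℕ) (α : OrdTerm) : Unmarked (ordCode d α) := by
  intro h
  have := below_enc d α (d + 1)
  rw [← map_val_encodeTerm (D := d + 1) α (by omega)] at this
  have := this (List.mem_map.2 ⟨_, h, Fin.val_last _⟩)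
  omega

theorem unmarked_counter (d n : ℕ) : Unmarked (counter d n) := by
  intro h
  have := congrArg Fin.val (List.eq_of_mem_replicate h)
  simp at this

theorem unmarked_nil (d : ℕ) : Unmarked ([] : Word d) := List.not_mem_nil

theorem robust_machine (d : ℕ) : (machine d).Robust := by
  intro α β hα hβ n m h
  obtain ⟨x, k, hX, -, hok⟩ :=
    inv_main_of_computes (unmarked_ordCode d α) (unmarked_counter d n) (unmarked_nil d) h
  rw [vals_mark] at hX
  have h₁ := List.append_cancel_right (congrFun hX 0)
  have h₂ := congrArg List.length (List.append_cancel_right (congrFun hX 1))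
  have hle := hok.hardy_le
  simp only [counter, List.length_map, List.length_replicate] at h₂ hle
  subst h₂
  rw [← h₁, ordCode, ordCode, map_val_encodeTerm _ (by omega), map_val_encodeTerm _ (by omega),
    decode_enc (fits_of_lt _ _ hα), decode_enc (fits_of_lt _ _ hβ)] at hle
  exact hle

/-- Contents over `ℕ` as contents over `Fin (d + 2)`. -/
def toFin (d : ℕ) (X : Chans) : Fin 3 → Word d := fun i => (X i).map (Fin.ofNat (d + 1 + 1))

theorem toFin_update (X : Chans) (i : Fin 3) (y : List ℕ) : toFin d (Function.update X i y)
    = Function.update (toFin d X) i (y.map (Fin.ofNat (d + 1 + 1))) := by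
  funext j
  by_cases h : j = i
  · subst h; simp [toFin]
  · simp [toFin, h]

theorem wstep_of_mem_rules {n n' : Fin (size d)} {i : Fin 3} {w : Bool} {l : ℕ} {ops : List Op}
    (hr : (n.val, i.val, w, l, n'.val) ∈ rules d) (hl : l ≤ d + 1) {X Y : Chans}
    (hX : Exact ((i, w, l) :: ops) X Y) :
    ∃ X', (machine d).toPCS.WStep (n, toFin d X) (n', toFin d X') ∧ Exact ops X' Y := by
  have hval : (Fin.ofNat (d + 1 + 1) l).val = l := Nat.mod_eq_of_lt (Nat.lt_succ_iff.2 hl)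
  cases w with
  | false =>
    obtain ⟨y, hy, hX⟩ := hX
    refine ⟨_, ?_, hX⟩
    rw [toFin_update]
    refine PCS.WStep.read (S := (machine d).toPCS) n n' i (Fin.ofNat _ l) (toFin d X) _ ?_
      (by simp [toFin, hy])
    change (n.val, i.val, false, (Fin.ofNat (d + 1 + 1) l).val, n'.val) ∈ rules d
    rwa [hval]
  | true =>
    refine ⟨_, ?_, hX⟩
    rw [toFin_update, List.map_append]
    refine PCS.WStep.write (S := (machine d).toPCS) n n' i (Fin.ofNat _ l) (toFin d X)
      (toFin d X i) [] ?_ (by simp) (by simp)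
    change (n.val, i.val, true, (Fin.ofNat (d + 1 + 1) l).val, n'.val) ∈ rules d
    rwa [hval]

/-- A lossless run from halfway along an edge to its end.  The final state is given by its number,
as the bound on state numbers comes from the last rule of the run. -/
theorem reaches_of_exact {p q : Phase} {ops : List Op} (he : Edge d p ops q) {Y : Chans} :
    ∀ {rest : List Op}, rest <:+ ops → ∀ {X : Chans}, Exact rest X Y → ∀ n : Fin (size d),
      n.val = encode ((rest, q.num) : Node) → ∃ m : Fin (size d), m.val = stateNum q ∧
        (machine d).toPCS.Reaches (n, toFin d X) (m, toFin d Y)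
  | [], _, X, hX, n, hn => by
    obtain rfl : X = Y := hX
    exact ⟨n, hn, .refl⟩
  | op :: rest, hs, X, hX, n, hn => by
    have hr := mem_rules.2 (.inr ⟨p, ops, q, op, rest, he, hs, rfl⟩)
    obtain ⟨X', hstep, hX'⟩ := wstep_of_mem_rules
      (n' := ⟨_, (stateNum_lt_size_of_mem hr).2⟩) (by rw [hn]; exact hr)
      (he.letter_le op (hs.subset (by simp))) hX
    obtain ⟨m, hm, h⟩ := reaches_of_exact he ((List.suffix_cons _ _).trans hs) hX'
      ⟨_, (stateNum_lt_size_of_mem hr).2⟩ rfl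
    exact ⟨m, hm, .head hstep h⟩

theorem reaches_of_edge {p q : Phase} {ops : List Op} (he : Edge d p ops q) {X Y : Chans}
    (hX : Exact ops X Y) (n : Fin (size d)) (hn : n.val = stateNum p) :
    ∃ m : Fin (size d), m.val = stateNum q ∧
      (machine d).toPCS.Reaches (n, toFin d X) (m, toFin d Y) := by
  cases ops with
  | nil => exact absurd rfl he.ne_nil
  | cons op rest =>
    have hr := mem_rules.2 (.inl ⟨p, op, rest, q, he, rfl⟩)
    obtain ⟨X', hstep, hX'⟩ := wstep_of_mem_rules
      (n' := ⟨_, (stateNum_lt_size_of_mem hr).2⟩) (by rw [hn]; exact hr)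
      (he.letter_le op (by simp)) hX
    obtain ⟨m, hm, h⟩ := reaches_of_exact he (List.suffix_cons _ _) hX'
      ⟨_, (stateNum_lt_size_of_mem hr).2⟩ rfl
    exact ⟨m, hm, .head hstep h⟩

theorem reaches_of_run {s s' : Phase × Chans} (h : Run d s s') (n : Fin (size d))
    (hn : n.val = stateNum s.1) : ∃ m : Fin (size d), m.val = stateNum s'.1 ∧
      (machine d).toPCS.Reaches (n, toFin d s.2) (m, toFin d s'.2) := by
  induction h with
  | refl => exact ⟨n, hn, .refl⟩
  | tail _ hs ih =>
    obtain ⟨m, hm, hr⟩ := ih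
    obtain ⟨ops, he, hX⟩ := hs
    obtain ⟨m', hm', hr'⟩ := reaches_of_edge he hX m hm
    exact ⟨m', hm', hr.trans hr'⟩

theorem toFin_marked (α : OrdTerm) (n : ℕ) :
    toFin d ![enc (d + 1) α ++ [d + 1], zeros n ++ [d + 1], [d + 1]]
      = ![mark (ordCode d α), mark (counter d n), mark []] := by
  funext i
  fin_cases i <;> simp [toFin, mark, ordCode, counter, map_ofNat_enc]

/-- Runs of the program between the codes of two terms are runs of the machine. -/
theorem computes_of_run {α β : OrdTerm} (hα : α < tower (d + 1)) {n m : ℕ} (hn : 1 ≤ n)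
    (h : Run d (mainConf d (enc (d + 1) α) n) (mainConf d (enc (d + 1) β) m)) :
    (machine d).Computes (mark (ordCode d α)) (mark (counter d n)) (mark [])
      (mark (ordCode d β)) (mark (counter d m)) (mark []) := by
  obtain ⟨n, rfl⟩ := Nat.exists_eq_add_of_le' hn
  have h₀ := run_check_main (below_enc d α) (isChain_enc (fits_of_lt _ _ hα)) n
  obtain ⟨q, hq, hr⟩ := reaches_of_run (h₀.trans h) (machine d).pInit rfl
  obtain rfl : q = (machine d).pFinal := Fin.ext hq
  rw [Computes, ← toFin_marked, ← toFin_marked]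
  exact hr

theorem isComplete_machine (d : ℕ) : (machine d).IsComplete := by
  intro α hα n hn
  obtain ⟨k, rfl⟩ := Nat.exists_eq_add_of_le' hn
  simpa [ordCode, encodeTerm] using computes_of_run (β := .zero) hα hn (by
    simpa using (run_hardy hα k).1)

theorem isInvComplete_machine (d : ℕ) : (machine d).IsInvComplete := by
  intro α hα n hn
  obtain ⟨k, rfl⟩ := Nat.exists_eq_add_of_le' hn
  have h1 : k + 1 ≤ α.hardy (k + 1) := by
    simpa [hardy_zero] using hardy_mono (.zero α) (le_refl (k + 1)) hn
  have h0 : (OrdTerm.zero : OrdTerm) < tower (d + 1) := by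
    change (0 : Ordinal) < 0 + Ordinal.omega0 ^ (tower d).toOrdinal
    rw [zero_add]
    exact Ordinal.opow_pos _ Ordinal.omega0_pos
  simpa [ordCode, encodeTerm] using computes_of_run (α := .zero) h0 (Nat.le_trans hn h1) (by
    simpa using (run_hardy hα k).2)

end HardyMachine

theorem mainTheorem6 :
    (∃ S : (d : ℕ) → HardyPCS d,
      (∀ d : ℕ, (S d).IsWeakHardyComputer ∧ (S d).IsComplete) ∧
      HardyPCS.UniformlyGenerated S) ∧
    (∃ S' : (d : ℕ) → HardyPCS d,
      (∀ d : ℕ, (S' d).IsWeakHardyComputer ∧ (S' d).IsInvComplete) ∧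
      HardyPCS.UniformlyGenerated S') :=
  open HardyMachine in
  ⟨⟨machine, fun d => ⟨⟨safe_machine d, robust_machine d⟩, isComplete_machine d⟩,
      uniformlyGenerated_machine⟩,
    ⟨machine, fun d => ⟨⟨safe_machine d, robust_machine d⟩, isInvComplete_machine d⟩,
      uniformlyGenerated_machine⟩⟩
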